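/- Let $S$ be a scheme and let $G$ be a smooth group scheme over $S$ (for instance a linear algebraic group, i.e. a smooth closed subgroup scheme of $\mathrm{GL}_{n,S}$). A category fibred in groupoids (CFG) is a fibred category over the category of $S$-schemes in which every morphism lying over an identity is an isomorphism; morphisms of CFGs are functors commuting with the projections to $S$-schemes, and an equivalence of CFGs is a morphism of CFGs that is an equivalence of categories. A $G$-torsor over an $S$-scheme $T$ is a smooth surjective $G$-invariant morphism $E\to T$ from an $S$-scheme $E$ with $G$-action such that $(g,e)\mapsto (ge,e)$ is an isomorphism $G\times_S E\to E\times_T E$. For an $S$-scheme $X$ with an action of $G$, let $[X/G]$ be the CFG whose objects over $T$ are pairs consisting of a $G$-torsor $E\to T$ and a $G$-equivariant morphism $E\to X$, and whose morphisms are cartesian diagrams of torsors with $G$-equivariant map of total spaces compatible with the maps to $X$. Let $X\to [X/G]$ be the morphism sending $x\colon T\to X$ to the trivial torsor $G\times_S T\to T$ with the map $(h,t)\mapsto h\,x(t)$. Let $\mathcal Y$ be a CFG and let $f\colon \mathcal Y\to [X/G]$ be a representable morphism, i.e. for every $S$-scheme $T$ and every morphism $T\to [X/G]$ the fibre product $T\times_{[X/G]}\mathcal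 Y$ is represented by an $S$-scheme. Then $X\times_{[X/G]}\mathcal Y$ is represented by an $S$-scheme. If $Y$ is any $S$-scheme with an equivalence $E\colon Y\to X\times_{[X/G]}\mathcal Y$, then there is exactly one action of $G$ on $Y$ induced by the action on $X$, that is, such that for all $g\in G(T)$ and $y\in Y(T)$ with $E(y)=(x,z,\varphi)$ the object $E(gy)$ is isomorphic over $T$ to $(gx,\,z,\,\varphi\circ\tau_g)$, where $\tau_g$ is the isomorphism from the image of $gx$ in $[X/G]$ to the image of $x$ given by right translation $(h,t)\mapsto (h\,g(t),t)$ of the trivial torsor. With this action, $\mathcal Y$ is equivalent to $[Y/G]$. -/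

import Mathlib

open CategoryTheory MonoidalCategory CartesianMonoidalCategory Limits AlgebraicGeometry
open scoped MonObj

universe v₁ v₂ v₃ u₁ u₂ u₃ u

/-- A category fibred in groupoids over `𝒮`: a fibred category `p : 𝒳 ⥤ 𝒮` in which every
morphism lying over an identity is an isomorphism. -/
structure IsCFG {𝒮 : Type u₁} [Category.{v₁} 𝒮] (𝒳 : BasedCategory.{v₂, u₂} 𝒮) : Prop where
  isFibered : 𝒳.p.IsFibered
  isIso_of_isHomLift_id : ∀ {T : 𝒮} {a b : 𝒳.obj} (α : a ⟶ b),
    𝒳.p.IsHomLift (𝟙 T) α → IsIso α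

/-- Equivalence of categories over `𝒮`: a functor commuting with the projections to `𝒮` which is
an equivalence of categories. (Between categories fibred in groupoids such a functor has a
quasi-inverse over `𝒮`.) -/
def CFGEquivalent {𝒮 : Type u₁} [Category.{v₁} 𝒮] (𝒳 : BasedCategory.{v₂, u₂} 𝒮)
    (𝒴 : BasedCategory.{v₃, u₃} 𝒮) : Prop :=
  ∃ F : BasedFunctor 𝒳 𝒴, F.toFunctor.IsEquivalence

/-- The fibre product `𝒳 ×_𝒵 𝒴`. An object is a triple `(x, y, φ)` where `x` and `y` lie over the
same object `T` of `𝒮` and `φ : F x ≅ G y` lies over `𝟙 T` (the condition on `φ` forces `y` to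
lie over the same object as `x`); a morphism is a pair `(α, β)` compatible with the `φ`s. -/
def fiberProduct {𝒮 : Type u₁} [Category.{v₁} 𝒮] {𝒳 : BasedCategory.{v₂, u₂} 𝒮}
    {𝒴 : BasedCategory.{v₃, u₃} 𝒮} {𝒵 : BasedCategory 𝒮}
    (F : BasedFunctor 𝒳 𝒵) (G : BasedFunctor 𝒴 𝒵) : BasedCategory 𝒮 :=
  BasedCategory.ofFunctor
    (𝒳 := ObjectProperty.FullSubcategory
      fun W : CategoricalPullback F.toFunctor G.toFunctor =>
        𝒵.p.IsHomLift (𝟙 (𝒳.p.obj W.fst)) W.iso.hom)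
    (ObjectProperty.ι _ ⋙ CategoricalPullback.π₁ _ _ ⋙ 𝒳.p)

/-- The category of `X`-schemes, fibred over the category of `S`-schemes. -/
def schemeCFG {S : Scheme.{u}} (X : Over S) : BasedCategory (Over S) :=
  BasedCategory.ofFunctor (Over.forget X)

/-- The fibred category `𝒳` is represented by the `S`-scheme `X`. -/
def IsRepresentedBy {S : Scheme.{u}} (𝒳 : BasedCategory.{v₂, u₂} (Over S)) (X : Over S) : Prop :=
  CFGEquivalent (schemeCFG X) 𝒳

/-- A morphism `f : 𝒴 → 𝒳` is representable if `T ×_𝒳 𝒴` is represented by a scheme for every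
`S`-scheme `T` and every morphism `t : T → 𝒳`. -/
def IsRepresentableMorphism {S : Scheme.{u}} {𝒳 : BasedCategory.{v₂, u₂} (Over S)}
    {𝒴 : BasedCategory.{v₃, u₃} (Over S)} (f : BasedFunctor 𝒴 𝒳) : Prop :=
  ∀ (T : Over S) (t : BasedFunctor (schemeCFG T) 𝒳),
    ∃ Z : Over S, IsRepresentedBy (fiberProduct t f) Z

noncomputable section


variable {C : Type u₁} [Category.{v₁} C] [CartesianMonoidalCategory C]

lemma whiskerLeft_isPullback (G : C) {T T' : C} (f : T ⟶ T') :
    IsPullback (G ◁ f) (snd G T) (snd G T') f := by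
  refine IsPullback.of_isLimit' ⟨by simp⟩ (PullbackCone.IsLimit.mk _
    (fun s => lift (s.fst ≫ fst _ _) s.snd) ?_ ?_ ?_)
  · intro s
    have h := s.condition
    ext <;> simp [h]
  · intro s; simp
  · intro s m h1 h2
    ext
    · simp [← h1]
    · simp [h2]

variable {G : C} [GrpObj G]

variable (G) in
/-- The map `G × (G × T) ⟶ G × T`, `(g, (h, t)) ↦ (g h, t)`. -/
abbrev trivialTorsorSMul (T : C) : G ⊗ (G ⊗ T) ⟶ G ⊗ T :=
  lift (fst G (G ⊗ T) * (snd G (G ⊗ T) ≫ fst G T)) (snd G (G ⊗ T) ≫ snd G T)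

variable (G) in
/-- The object `G × T`, on which `G` acts by `g (h, t) = (g h, t)`. -/
def trivialTorsor (T : C) : Mod C G where
  X := G ⊗ T
  mod :=
    { smul := trivialTorsorSMul G T
      one_smul := by
        ext <;> simp [MonObj.comp_mul, MonObj.one_eq_one, MonObj.comp_one, leftUnitor_hom]
      mul_smul := by
        ext <;> simp [MonObj.comp_mul, MonObj.mul_eq_mul, mul_assoc] }

variable (G) in
lemma trivialTorsor_isPullback (T : C) :
    IsPullback γ[G, (trivialTorsor G T).X] (snd G (G ⊗ T)) (snd G T) (snd G T) := by
  change IsPullback (trivialTorsorSMul G T) _ _ _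
  refine IsPullback.of_isLimit' ⟨by simp⟩ (PullbackCone.IsLimit.mk _
    (fun s => lift ((s.fst ≫ fst G T) * (s.snd ≫ fst G T)⁻¹) s.snd) ?_ ?_ ?_)
  · intro s
    have h := s.condition
    ext <;> simp [MonObj.comp_mul, h]
  · intro s; simp
  · intro s m h1 h2
    have h3 := congr($h1 ≫ fst G T)
    ext
    · simp [MonObj.comp_mul, reassoc_of% h2] at h3
      simp [← h3]
    · simpa using congr($h2 ≫ fst G T)
    · simpa using congr($h2 ≫ snd G T)

variable (G) in
/-- The morphism of trivial torsors `(h, t) ↦ (h, f t)`. -/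
def trivialTorsorMap {T T' : C} (f : T ⟶ T') : trivialTorsor G T ⟶ trivialTorsor G T' :=
  Mod.Hom.mk' (G ◁ f) (by
    change trivialTorsorSMul G T ≫ G ◁ f = G ◁ (G ◁ f) ≫ trivialTorsorSMul G T'
    ext <;> simp [MonObj.comp_mul])

lemma trivialTorsorMap_isPullback {T T' : C} (f : T ⟶ T') :
    IsPullback (trivialTorsorMap G f).hom (snd G T) (snd G T') f :=
  whiskerLeft_isPullback G f

/-- The equivariant map `(h, t) ↦ h x(t)` from the trivial torsor over `T` to `X`. -/
def orbitMap {X : Mod C G} {T : C} (x : T ⟶ X.X) : trivialTorsor G T ⟶ X :=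
  Mod.Hom.mk' (fst G T • (snd G T ≫ x)) (by
    change trivialTorsorSMul G T ≫ (fst G T • (snd G T ≫ x)) =
      G ◁ (fst G T • (snd G T ≫ x)) ≫ γ[G, X.X]
    have h : ∀ {A B : C} (f : A ⟶ B), G ◁ f = lift (fst G A) (snd G A ≫ f) := by
      intro A B f; ext <;> simp
    rw [h, ← Hom.smul_def, ModObj.comp_smul, ModObj.comp_smul, smul_smul]
    simp)

/-- Right translation `(h, t) ↦ (h g(t), t)` of the trivial torsor over `T` by `g : T → G`. -/
def rightTranslation {T : C} (g : T ⟶ G) : trivialTorsor G T ⟶ trivialTorsor G T :=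
  Mod.Hom.mk' (lift (fst G T * (snd G T ≫ g)) (snd G T)) (by
    change trivialTorsorSMul G T ≫ lift (fst G T * (snd G T ≫ g)) (snd G T) =
      G ◁ lift (fst G T * (snd G T ≫ g)) (snd G T) ≫ trivialTorsorSMul G T
    ext <;> simp [MonObj.comp_mul, mul_assoc])

lemma rightTranslation_comp {T : C} (g h : T ⟶ G) :
    rightTranslation g ≫ rightTranslation h = rightTranslation (g * h) := by
  apply Mod.hom_ext
  change lift (fst G T * (snd G T ≫ g)) (snd G T) ≫ lift (fst G T * (snd G T ≫ h)) (snd G T) =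
    lift (fst G T * (snd G T ≫ (g * h))) (snd G T)
  ext <;> simp [MonObj.comp_mul, mul_assoc]

lemma rightTranslation_one {T : C} : rightTranslation (1 : T ⟶ G) = 𝟙 _ := by
  apply Mod.hom_ext
  change lift (fst G T * (snd G T ≫ 1)) (snd G T) = 𝟙 (G ⊗ T)
  ext <;> simp [MonObj.comp_one]

lemma rightTranslation_isPullback {T : C} (g : T ⟶ G) :
    IsPullback (rightTranslation g).hom (snd G T) (snd G T) (𝟙 T) := by
  have : IsIso (rightTranslation g).hom := by
    refine ⟨(rightTranslation g⁻¹).hom, ?_, ?_⟩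
    · rw [← Mod.comp_hom', rightTranslation_comp, mul_inv_cancel, rightTranslation_one]; rfl
    · rw [← Mod.comp_hom', rightTranslation_comp, inv_mul_cancel, rightTranslation_one]; rfl
  exact IsPullback.of_horiz_isIso ⟨by
    change lift (fst G T * (snd G T ≫ g)) (snd G T) ≫ snd G T = snd G T ≫ 𝟙 T
    rw [lift_snd, Category.comp_id]⟩

lemma rightTranslation_orbitMap {X : Mod C G} {T : C} (g : T ⟶ G) (x : T ⟶ X.X) :
    rightTranslation g ≫ orbitMap x = orbitMap (g • x) := by
  apply Mod.hom_ext
  change lift (fst G T * (snd G T ≫ g)) (snd G T) ≫ (fst G T • (snd G T ≫ x)) =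
    fst G T • (snd G T ≫ (g • x))
  rw [ModObj.comp_smul, ModObj.comp_smul, smul_smul]
  simp

lemma trivialTorsorMap_orbitMap {X : Mod C G} {T T' : C} (f : T ⟶ T') (x : T' ⟶ X.X) :
    trivialTorsorMap G f ≫ orbitMap x = orbitMap (f ≫ x) := by
  apply Mod.hom_ext
  change G ◁ f ≫ (fst G T' • (snd G T' ≫ x)) = fst G T • (snd G T ≫ f ≫ x)
  rw [ModObj.comp_smul]
  simp

end

noncomputable section

variable {S : Scheme.{u}} {G : Over S} [GrpObj G]


/-- `p : E → T` is a `G`-torsor: `p` is smooth and surjective, it is `G`-invariant, and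
`(g, e) ↦ (g e, e)` is an isomorphism `G × E ≅ E ×_T E` (so that `G` acts freely on `E`). -/
structure IsTorsor (E : Mod (Over S) G) {T : Over S} (p : E.X ⟶ T) : Prop where
  smooth : Smooth p.left
  surjective : Surjective p.left
  isPullback : IsPullback γ[G, E.X] (snd G E.X) p p

/-- An object of `[X/G]`: a `G`-torsor `E → T` with a `G`-equivariant map `E → X`. -/
structure QuotientObj (X : Mod (Over S) G) where
  base : Over S
  total : Mod (Over S) G
  proj : total.X ⟶ base
  isTorsor : IsTorsor total proj
  map : total ⟶ X

/-- A morphism of `[X/G]`: a cartesian diagram of torsors, with `E' → E` being `G`-equivariant and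
compatible with the maps to `X`. -/
@[ext]
structure QuotientHom {X : Mod (Over S) G} (a b : QuotientObj X) where
  base : a.base ⟶ b.base
  total : a.total ⟶ b.total
  isPullback : IsPullback total.hom a.proj b.proj base
  w : total ≫ b.map = a.map

instance (X : Mod (Over S) G) : Category (QuotientObj X) where
  Hom a b := QuotientHom a b
  id a := ⟨𝟙 _, 𝟙 _, IsPullback.id_horiz _, by simp⟩
  comp f g := ⟨f.base ≫ g.base, f.total ≫ g.total, f.isPullback.paste_horiz g.isPullback,
    by rw [Category.assoc, g.w, f.w]⟩
  id_comp f := QuotientHom.ext (Category.id_comp _) (Category.id_comp _)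
  comp_id f := QuotientHom.ext (Category.comp_id _) (Category.comp_id _)
  assoc f g h := QuotientHom.ext (Category.assoc _ _ _) (Category.assoc _ _ _)

/-- The quotient `[X/G]`, fibred over the category of `S`-schemes by `(E → T, E → X) ↦ T`. -/
def quotientCFG (X : Mod (Over S) G) : BasedCategory (Over S) :=
  BasedCategory.ofFunctor (𝒳 := QuotientObj X)
    { obj := fun a => a.base
      map := fun f => QuotientHom.base f
      map_id := fun _ => rfl
      map_comp := fun _ _ => rfl }

variable (G) in
lemma trivialTorsor_isTorsor [Smooth G.hom] (T : Over S) :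
    IsTorsor (trivialTorsor G T) (snd G T) where
  smooth := by
    change Smooth (pullback.snd G.hom T.hom)
    infer_instance
  surjective := by
    have h : lift (toUnit T ≫ η[G]) (𝟙 T) ≫ snd G T = 𝟙 T := by simp
    have h' : (lift (toUnit T ≫ η[G]) (𝟙 T)).left ≫ (snd G T).left = 𝟙 T.left :=
      congrArg CommaMorphism.left h
    refine ⟨fun t => ⟨(lift (toUnit T ≫ η[G]) (𝟙 T)).left t, ?_⟩⟩
    exact congr($h' t)
  isPullback := trivialTorsor_isPullback G T

/-- The morphism `X → [X/G]`: it sends `x : T → X` to the trivial torsor `G × T → T` with the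
equivariant map `(h, t) ↦ h x(t)`. -/
def quotientMap [Smooth G.hom] (X : Mod (Over S) G) :
    BasedFunctor (schemeCFG X.X) (quotientCFG X) where
  obj x := QuotientObj.mk (X := X) x.left (trivialTorsor G x.left) (snd G x.left)
    (trivialTorsor_isTorsor G x.left) (orbitMap x.hom)
  map {x y} f := QuotientHom.mk f.left (trivialTorsorMap G f.left)
    (trivialTorsorMap_isPullback f.left)
    ((trivialTorsorMap_orbitMap f.left y.hom).trans (by rw [Over.w f]))
  map_id x := QuotientHom.ext rfl (Mod.hom_ext _ _ (whiskerLeft_id _ _))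
  map_comp f g := QuotientHom.ext rfl (Mod.hom_ext _ _ (whiskerLeft_comp _ _ _))
  w := rfl

/-- For `x : T → X` and `g : T → G`, the isomorphism in `[X/G](T)` from the image of `g x` to the
image of `x`, given on the torsors by `(h, t) ↦ (h g(t), t)`. -/
def translateIso [Smooth G.hom] (X : Mod (Over S) G) (x : Over X.X) (g : x.left ⟶ G) :
    (quotientMap X).obj (Over.mk (g • x.hom)) ≅ (quotientMap X).obj x where
  hom := QuotientHom.mk (𝟙 x.left) (rightTranslation g) (rightTranslation_isPullback g)
    (rightTranslation_orbitMap g x.hom)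
  inv := QuotientHom.mk (𝟙 x.left) (rightTranslation g⁻¹) (rightTranslation_isPullback g⁻¹)
    ((rightTranslation_orbitMap g⁻¹ (g • x.hom)).trans (by rw [inv_smul_smul]; rfl))
  hom_inv_id := QuotientHom.ext (Category.id_comp _)
    ((rightTranslation_comp _ _).trans (by rw [mul_inv_cancel, rightTranslation_one]; rfl))
  inv_hom_id := QuotientHom.ext (Category.id_comp _)
    ((rightTranslation_comp _ _).trans (by rw [inv_mul_cancel, rightTranslation_one]; rfl))

lemma translateIso_isHomLift [Smooth G.hom] (X : Mod (Over S) G) (x : Over X.X)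
    (g : x.left ⟶ G) : (quotientCFG X).p.IsHomLift (𝟙 x.left) (translateIso X x g).hom :=
  IsHomLift.map (quotientCFG X).p (translateIso X x g).hom

/-- The action of `g : T → G` on an object `W = (x, y, φ)` of `(X ×_[X/G] 𝒴)(T)`: the result is
`(g x, y, φ ∘ τ)`, where `τ` is the isomorphism between the images of `g x` and `x` in `[X/G]`. -/
def fiberProductSMul [Smooth G.hom] {X : Mod (Over S) G} {𝒴 : BasedCategory.{v₂, u₂} (Over S)}
    (f : BasedFunctor 𝒴 (quotientCFG X)) (W : (fiberProduct (quotientMap X) f).obj)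
    (g : (fiberProduct (quotientMap X) f).p.obj W ⟶ G) :
    (fiberProduct (quotientMap X) f).obj where
  obj :=
    { fst := Over.mk (HSMul.hSMul (α := W.obj.fst.left ⟶ G) g W.obj.fst.hom)
      snd := W.obj.snd
      iso := translateIso X W.obj.fst g ≪≫ W.obj.iso }
  property := by
    have h₁ := translateIso_isHomLift X W.obj.fst g
    have h₂ : (quotientCFG X).p.IsHomLift (𝟙 W.obj.fst.left) W.obj.iso.hom := W.property
    have h := IsHomLift.comp (quotientCFG X).p (𝟙 W.obj.fst.left) (𝟙 W.obj.fst.left)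
      (translateIso X W.obj.fst g).hom W.obj.iso.hom
    rw [Category.comp_id] at h
    exact h

/-- Let `E : Y → X ×_[X/G] 𝒴` be a morphism. An action of `G` on `Y` is induced from the action on
`X` through `E` if, for all `g : T → G` and `y : T → Y`, the objects `E (g y)` and `g E(y)` of
`(X ×_[X/G] 𝒴)(T)` are isomorphic over `𝟙 T`. (The object `E y` lies over `T` up to an equality of
objects; hence the `eqToHom`.) -/
def IsInducedAction [Smooth G.hom] {X : Mod (Over S) G} {𝒴 : BasedCategory.{v₂, u₂} (Over S)}
    (f : BasedFunctor 𝒴 (quotientCFG X)) {Y : Over S}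
    (E : BasedFunctor (schemeCFG Y) (fiberProduct (quotientMap X) f)) (act : ModObj G Y) : Prop :=
  ∀ (T : Over S) (g : T ⟶ G) (y : T ⟶ Y),
    ∃ θ : E.obj (Over.mk (g • y)) ≅
        fiberProductSMul f (E.obj (Over.mk y)) (eqToHom (E.w_obj (Over.mk y)) ≫ g),
      (fiberProduct (quotientMap X) f).p.IsHomLift (𝟙 T) θ.hom

end

/-! Write `F` for the functor underlying `f`. A trivialization of a torsor is the same as a section,
so an object of `X ×_[X/G] 𝒴` over `T` amounts to an object `z` of `𝒴` over `T` with a section of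
the torsor `F z`. A scheme `Y` representing this fibre product therefore carries a universal such
pair (`UniversalSection`), and `G` acts on `Y` by moving the section. For an arbitrary `z`, with
total space `P` of `F z`, the pullback of `z` to `P` has a tautological section, hence a classifying
map `P → Y` (`toBase`). It is equivariant, and `z ↦ (F z, P → Y)` is the functor to `[Y/G]`.

This functor is an equivalence by descent along torsors, although `𝒴` is not assumed to be a stack.
The descent comes from representability: for each `b` in `[X/G]` the pairs `(z, F z ⟶ b)` have a
terminal object, whose base is a scheme over that of `b`, and morphisms into a scheme descend along
smooth surjections. Uniqueness of maps to the terminal pair makes `F` faithful. Fullness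
(`exists_map_eq`) and essential surjectivity (`exists_obj`) are settled over `P`, where the torsor
is trivial, and the resulting map of bases is then descended.

Objects of `X ×_[X/G] 𝒴` over `T` are classified, up to isomorphism over `T`, by points of `Y`
(`classify`); this determines `g y` and hence the action. -/

noncomputable section

variable {S : Scheme.{u}} {G : Over S} [GrpObj G] {X : Mod (Over S) G}

/-! ### Cartesian morphisms and pullbacks in `[X/G]` -/

namespace QuotientObj

@[simp]
lemma id_base (a : QuotientObj X) : QuotientHom.base (𝟙 a) = 𝟙 a.base := rfl

@[simp]
lemma id_total (a : QuotientObj X) : QuotientHom.total (𝟙 a) = 𝟙 a.total := rfl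

@[simp]
lemma comp_base {a b c : QuotientObj X} (f : a ⟶ b) (g : b ⟶ c) :
    QuotientHom.base (f ≫ g) = QuotientHom.base f ≫ QuotientHom.base g := rfl

@[simp]
lemma comp_total {a b c : QuotientObj X} (f : a ⟶ b) (g : b ⟶ c) :
    QuotientHom.total (f ≫ g) = QuotientHom.total f ≫ QuotientHom.total g := rfl

lemma hom_ext {a b : QuotientObj X} {f g : a ⟶ b}
    (h₁ : QuotientHom.base f = QuotientHom.base g)
    (h₂ : (QuotientHom.total f).hom = (QuotientHom.total g).hom) : f = g :=
  QuotientHom.ext h₁ (Mod.hom_ext _ _ h₂)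

lemma total_proj {a b : QuotientObj X} (f : a ⟶ b) :
    (QuotientHom.total f).hom ≫ b.proj = a.proj ≫ QuotientHom.base f :=
  (QuotientHom.isPullback f).w

lemma total_proj_assoc {a b : QuotientObj X} (f : a ⟶ b) {T : Over S} (t : b.base ⟶ T) :
    (QuotientHom.total f).hom ≫ b.proj ≫ t = a.proj ≫ QuotientHom.base f ≫ t := by
  rw [← Category.assoc, total_proj, Category.assoc]

lemma total_map {a b : QuotientObj X} (f : a ⟶ b) :
    (QuotientHom.total f).hom ≫ b.map.hom = a.map.hom :=
  congrArg Mod.Hom.hom (QuotientHom.w f)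

lemma smul_proj (a : QuotientObj X) {T : Over S} (g : T ⟶ G) (s : T ⟶ a.total.X) :
    (g • s) ≫ a.proj = s ≫ a.proj := by
  rw [Hom.smul_def, Category.assoc, a.isTorsor.isPullback.w]
  simp

end QuotientObj

/-- A map induced by equivariant data into a pullback of torsors is equivariant. -/
lemma smul_lift_of_isPullback {E E' : Mod (Over S) G} {P : Mod (Over S) G} {T T' : Over S}
    {p : E.X ⟶ T} {p' : P.X ⟶ T'} {c : T' ⟶ T} {k : P ⟶ E} (hP : IsPullback k.hom p' p c)
    (hp' : γ[G, P.X] ≫ p' = snd G P.X ≫ p') (v : E' ⟶ E) (q : E'.X ⟶ T')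
    (hq : γ[G, E'.X] ≫ q = snd G E'.X ≫ q) (l : E'.X ⟶ P.X)
    (h₁ : l ≫ k.hom = v.hom) (h₂ : l ≫ p' = q) :
    γ[G, E'.X] ≫ l = G ◁ l ≫ γ[G, P.X] := by
  apply hP.hom_ext
  · have hk := IsModHom.smul_hom (A := G) (f := k.hom)
    have hv := IsModHom.smul_hom (A := G) (f := v.hom)
    simp only [Category.assoc, h₁]
    rw [hk, hv]
    simp [← h₁]
  · simp only [Category.assoc, h₂, hp', hq]
    simp [h₂]

namespace QuotientObj

/-- Every morphism of `[X/G]` is cartesian: existence of factorizations. -/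
lemma exists_fac {a b c : QuotientObj X} (u : b ⟶ c) (v : a ⟶ c) (t : a.base ⟶ b.base)
    (h : t ≫ QuotientHom.base u = QuotientHom.base v) :
    ∃ k : a ⟶ b, QuotientHom.base k = t ∧ k ≫ u = v := by
  have hu := QuotientHom.isPullback u
  have hv := QuotientHom.isPullback v
  have w : (QuotientHom.total v).hom ≫ c.proj = (a.proj ≫ t) ≫ QuotientHom.base u := by
    rw [total_proj, Category.assoc, h]
  let l := hu.lift _ _ w
  have hl₁ : l ≫ (QuotientHom.total u).hom = (QuotientHom.total v).hom := hu.lift_fst _ _ w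
  have hl₂ : l ≫ b.proj = a.proj ≫ t := hu.lift_snd _ _ w
  let K : a.total ⟶ b.total := Mod.Hom.mk' l
    (smul_lift_of_isPullback hu b.isTorsor.isPullback.w (QuotientHom.total v) (a.proj ≫ t)
      (by rw [reassoc_of% a.isTorsor.isPullback.w]) l hl₁ hl₂)
  refine ⟨⟨t, K, ?_, ?_⟩, rfl, ?_⟩
  · refine IsPullback.of_right (h₁₂ := (QuotientHom.total u).hom) (h₂₂ := QuotientHom.base u)
      ?_ hl₂ hu
    change IsPullback (l ≫ _) _ _ _
    rw [hl₁, h]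
    exact hv
  · apply Mod.hom_ext
    change l ≫ b.map.hom = a.map.hom
    rw [← total_map u, reassoc_of% hl₁, total_map]
  · exact hom_ext h hl₁

lemma fac_unique {a b c : QuotientObj X} (u : b ⟶ c) {k k' : a ⟶ b}
    (h : QuotientHom.base k = QuotientHom.base k') (h' : k ≫ u = k' ≫ u) : k = k' := by
  refine hom_ext h ((QuotientHom.isPullback u).hom_ext ?_ ?_)
  · exact congr((QuotientHom.total $h').hom)
  · rw [total_proj, total_proj, h]

lemma isIso_of_isIso_base {a b : QuotientObj X} (u : a ⟶ b) [IsIso (QuotientHom.base u)] :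
    IsIso u := by
  obtain ⟨k, hk, hk'⟩ := exists_fac u (𝟙 b) (inv (QuotientHom.base u)) (by simp)
  exact ⟨k, fac_unique u (by simp [hk]) (by simp [hk']), hk'⟩

/-- The action of `G` on the pullback of a `G`-invariant morphism. -/
@[reducible]
def pullbackModObj {E : Mod (Over S) G} {T T' : Over S} {p : E.X ⟶ T}
    (hp : γ[G, E.X] ≫ p = snd G E.X ≫ p) {P : Over S} {k : P ⟶ E.X} {p' : P ⟶ T'} {c : T' ⟶ T}
    (hP : IsPullback k p' p c) : ModObj G P where
  smul := hP.lift (G ◁ k ≫ γ[G, E.X]) (snd G P ≫ p') (by simp [hp, hP.w])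
  one_smul := by
    apply hP.hom_ext
    · simp [← whisker_exchange_assoc]
    · simp [leftUnitor_hom]
  mul_smul := by
    apply hP.hom_ext
    · have h : G ◁ hP.lift (G ◁ k ≫ γ[G, E.X]) (snd G P ≫ p') (by simp [hp, hP.w]) ≫ G ◁ k =
          G ◁ (G ◁ k ≫ γ[G, E.X]) := by
        rw [← MonoidalCategory.whiskerLeft_comp, hP.lift_fst]
      simp [reassoc_of% h, ← whisker_exchange_assoc]
    · simp

/-- Smoothness and surjectivity are stable under base change; the torsor square follows by pasting
with the pullback square and cancelling it. -/
lemma pullback_isTorsor {E : Mod (Over S) G} {T T' : Over S} {p : E.X ⟶ T}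
    (hp : IsTorsor E p) {P : Over S} {k : P ⟶ E.X} {p' : P ⟶ T'} {c : T' ⟶ T}
    (hP : IsPullback k p' p c) :
    letI := pullbackModObj hp.isPullback.w hP
    IsTorsor (G := G) ⟨P⟩ p' := by
  let := pullbackModObj hp.isPullback.w hP
  have hP' : IsPullback k.left p'.left p.left c.left := hP.map (Over.forget S)
  have h₁ : γ[G, P] ≫ k = G ◁ k ≫ γ[G, E.X] := hP.lift_fst _ _ _
  have h₂ : γ[G, P] ≫ p' = snd G P ≫ p' := hP.lift_snd _ _ _
  refine ⟨?_, ?_, ?_⟩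
  · exact MorphismProperty.of_isPullback (P := @Smooth) hP' hp.smooth
  · exact MorphismProperty.of_isPullback (P := @Surjective) hP' hp.surjective
  · refine IsPullback.of_right (h₁₂ := k) (h₂₂ := c) (v₁₃ := p) ?_ h₂ hP
    rw [h₁, ← hP.w]
    exact (whiskerLeft_isPullback G k).paste_horiz hp.isPullback

/-- The pullback of an object of `[X/G]`. -/
def pullbackObj (b : QuotientObj X) {T : Over S} (c : T ⟶ b.base) : QuotientObj X :=
  letI := pullbackModObj b.isTorsor.isPullback.w (IsPullback.of_hasPullback b.proj c)
  { base := T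
    total := ⟨pullback b.proj c⟩
    proj := pullback.snd b.proj c
    isTorsor := pullback_isTorsor b.isTorsor (IsPullback.of_hasPullback b.proj c)
    map := Mod.Hom.mk' (M := ⟨pullback b.proj c⟩) (pullback.fst b.proj c)
      ((IsPullback.of_hasPullback b.proj c).lift_fst _ _ _) ≫ b.map }

/-- The projection from the pullback of an object of `[X/G]`. -/
def pullbackπ (b : QuotientObj X) {T : Over S} (c : T ⟶ b.base) : b.pullbackObj c ⟶ b :=
  letI := pullbackModObj b.isTorsor.isPullback.w (IsPullback.of_hasPullback b.proj c)
  QuotientHom.mk (a := b.pullbackObj c) c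
    (Mod.Hom.mk' (M := (b.pullbackObj c).total) (pullback.fst b.proj c)
      ((IsPullback.of_hasPullback b.proj c).lift_fst _ _ _))
    (IsPullback.of_hasPullback b.proj c) rfl

/-- The morphism `T → [X/G]` given by an object of `[X/G]` over `T`. -/
def pullbackFunctor (b : QuotientObj X) : BasedFunctor (schemeCFG b.base) (quotientCFG X) where
  obj c := b.pullbackObj (T := c.left) c.hom
  -- The chosen factorization is unique by `fac_unique`, which yields functoriality.
  map {c d} t := (exists_fac (b.pullbackπ (T := d.left) d.hom) (b.pullbackπ (T := c.left) c.hom)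
    t.left (Over.w t)).choose
  map_id c := by
    have h := (exists_fac (b.pullbackπ (T := c.left) c.hom) (b.pullbackπ (T := c.left) c.hom)
      (CommaMorphism.left (𝟙 c)) (Over.w (𝟙 c))).choose_spec
    exact fac_unique (b.pullbackπ (T := c.left) c.hom) h.1 (h.2.trans (Category.id_comp _).symm)
  map_comp {c d e} t s := by
    have h₁ := (exists_fac (b.pullbackπ (T := d.left) d.hom) (b.pullbackπ (T := c.left) c.hom)
      t.left (Over.w t)).choose_spec
    have h₂ := (exists_fac (b.pullbackπ (T := e.left) e.hom) (b.pullbackπ (T := d.left) d.hom)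
      s.left (Over.w s)).choose_spec
    have h₃ := (exists_fac (b.pullbackπ (T := e.left) e.hom) (b.pullbackπ (T := c.left) c.hom)
      (CommaMorphism.left (t ≫ s)) (Over.w (t ≫ s))).choose_spec
    refine fac_unique (b.pullbackπ (T := e.left) e.hom) (h₃.1.trans ?_) (h₃.2.trans ?_)
    · exact (congrArg₂ (· ≫ ·) h₁.1 h₂.1).symm
    · exact h₁.2.symm.trans ((congrArg (_ ≫ ·) h₂.2.symm).trans (Category.assoc _ _ _).symm)
  w := by
    refine CategoryTheory.Functor.ext (fun _ => rfl) (fun c d t => ?_)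
    refine (exists_fac (b.pullbackπ (T := d.left) d.hom) (b.pullbackπ (T := c.left) c.hom)
      t.left (Over.w t)).choose_spec.1.trans ?_
    exact ((Category.id_comp _).trans (Category.comp_id _)).symm

lemma pullbackFunctor_map_base (b : QuotientObj X) {c d : Over b.base} (t : c ⟶ d) :
    QuotientHom.base (b.pullbackFunctor.map t) = t.left :=
  (exists_fac (b.pullbackπ (T := d.left) d.hom) (b.pullbackπ (T := c.left) c.hom)
      t.left (Over.w t)).choose_spec.1

lemma pullbackFunctor_map_π (b : QuotientObj X) {c d : Over b.base} (t : c ⟶ d) :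
    b.pullbackFunctor.map t ≫ b.pullbackπ (T := d.left) d.hom =
      b.pullbackπ (T := c.left) c.hom :=
  (exists_fac (b.pullbackπ (T := d.left) d.hom) (b.pullbackπ (T := c.left) c.hom)
      t.left (Over.w t)).choose_spec.2

end QuotientObj

end

noncomputable section

/-! ### Equivariant maps out of a trivial torsor -/

section TrivialTorsor

variable {C : Type u₁} [Category.{v₁} C] [CartesianMonoidalCategory C] {G : C} [GrpObj G]

variable (G) in
/-- The section `t ↦ (1, t)` of the trivial torsor. -/
def unitSection (T : C) : T ⟶ (trivialTorsor G T).X :=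
  lift (1 : T ⟶ G) (𝟙 T)

lemma unitSection_snd_assoc (T : C) {Z : C} (t : T ⟶ Z) :
    unitSection G T ≫ snd G T ≫ t = t :=
  lift_snd_assoc _ _ _ |>.trans (Category.id_comp _)

lemma smul_comp_unitSection (T : C) {Z : C} (g : Z ⟶ G) (t : Z ⟶ T) :
    (g • (t ≫ unitSection G T) : Z ⟶ (trivialTorsor G T).X) = lift g t := by
  change lift g (t ≫ lift 1 (𝟙 T)) ≫ trivialTorsorSMul G T = _
  ext <;> simp [MonObj.comp_mul, MonObj.comp_one]

@[simp]
lemma unitSection_orbitMap {X : Mod C G} {T : C} (x : T ⟶ X.X) :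
    unitSection G T ≫ (orbitMap x).hom = x := by
  change lift (1 : T ⟶ G) (𝟙 T) ≫ (fst G T • (snd G T ≫ x) : G ⊗ T ⟶ X.X) = x
  rw [ModObj.comp_smul, lift_snd_assoc, lift_fst, one_smul, Category.id_comp]

lemma trivialTorsor_hom_ext {T : C} {M : Mod C G} {φ φ' : trivialTorsor G T ⟶ M}
    (h : unitSection G T ≫ φ.hom = unitSection G T ≫ φ'.hom) : φ = φ' := by
  apply Mod.hom_ext
  have h₁ (ψ : trivialTorsor G T ⟶ M) :
      ψ.hom = (fst G T • (snd G T ≫ unitSection G T ≫ ψ.hom) : G ⊗ T ⟶ M.X) := by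
    rw [← Category.assoc, ← IsModHom.map_smul, smul_comp_unitSection, lift_fst_snd]
    exact (Category.id_comp _).symm
  rw [h₁ φ, h₁ φ', h]

lemma unitSection_trivialTorsorMap {T T' : C} (t : T ⟶ T') :
    unitSection G T ≫ (trivialTorsorMap G t).hom = t ≫ unitSection G T' := by
  change lift 1 (𝟙 T) ≫ G ◁ t = t ≫ lift 1 (𝟙 T')
  ext <;> simp [MonObj.comp_one]

lemma unitSection_rightTranslation {T : C} (g : T ⟶ G) :
    unitSection G T ≫ (rightTranslation g).hom = g • unitSection G T := by
  have h := smul_comp_unitSection T g (𝟙 T)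
  rw [Category.id_comp] at h
  rw [h]
  change lift 1 (𝟙 T) ≫ lift (fst G T * (snd G T ≫ g)) (snd G T) = _
  ext <;> simp [MonObj.comp_mul]

end TrivialTorsor

variable {S : Scheme.{u}} {G : Over S} [GrpObj G] {X : Mod (Over S) G}

/-! ### Descent along torsors, and torsors with a section -/

namespace QuotientObj

instance epi_proj (a : QuotientObj X) : Epi a.proj := by
  have := a.isTorsor.smooth
  have := a.isTorsor.surjective
  have : Epi ((Over.forget S).map a.proj) := inferInstanceAs (Epi a.proj.left)
  exact (Over.forget S).epi_of_epi_map this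

/-- Torsors are effective epimorphisms: `G`-invariant morphisms descend to the base. -/
lemma exists_desc (a : QuotientObj X) {B : Over S} (r : a.total.X ⟶ B)
    (h : γ[G, a.total.X] ≫ r = snd G a.total.X ≫ r) : ∃ r' : a.base ⟶ B, a.proj ≫ r' = r := by
  have := a.isTorsor.smooth
  have := a.isTorsor.surjective
  have h₁ : ∀ {Z : Scheme.{u}} (g₁ g₂ : Z ⟶ a.total.X.left),
      g₁ ≫ a.proj.left = g₂ ≫ a.proj.left → g₁ ≫ r.left = g₂ ≫ r.left := by
    intro Z g₁ g₂ hg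
    have hg₂ : g₂ ≫ a.total.X.hom = g₁ ≫ a.total.X.hom := by
      rw [← Over.w a.proj, reassoc_of% hg]
    let k₁ : Over.mk (g₁ ≫ a.total.X.hom) ⟶ a.total.X := Over.homMk g₁
    let k₂ : Over.mk (g₁ ≫ a.total.X.hom) ⟶ a.total.X := Over.homMk g₂ hg₂
    have hk : k₁ ≫ a.proj = k₂ ≫ a.proj := Over.OverMorphism.ext hg
    have h₂ : k₁ ≫ r = k₂ ≫ r := by
      -- Two points with the same image in the base have the form `(g e, e)`, so invariance of `r`
      -- identifies their images.
      rw [← a.isTorsor.isPullback.lift_fst k₁ k₂ hk, Category.assoc, h,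
        a.isTorsor.isPullback.lift_snd_assoc]
    exact congrArg CommaMorphism.left h₂
  have h₃ : a.proj.left ≫ EffectiveEpi.desc a.proj.left r.left h₁ = r.left :=
    EffectiveEpi.fac _ _ _
  refine ⟨Over.homMk (EffectiveEpi.desc a.proj.left r.left h₁) ?_, Over.OverMorphism.ext h₃⟩
  rw [← cancel_epi a.proj.left, reassoc_of% h₃, Over.w, Over.w]

variable [Smooth G.hom]

/-- The trivial torsor as an object of `[X/G]`. -/
def trivialObj {T : Over S} (x : T ⟶ X.X) : QuotientObj X where
  base := T
  total := trivialTorsor G T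
  proj := snd G T
  isTorsor := trivialTorsor_isTorsor G T
  map := orbitMap x

/-- The morphism from a trivial torsor given by a point of the total space. -/
def pointHom {b : QuotientObj X} {T : Over S} (a : T ⟶ b.total.X) {x : T ⟶ X.X}
    (h : a ≫ b.map.hom = x) : trivialObj x ⟶ b :=
  QuotientHom.mk (a := trivialObj x) (a ≫ b.proj) (orbitMap a)
    (by
      have h₁ : (orbitMap a).hom = G ◁ a ≫ γ[G, b.total.X] := by
        change lift (fst G T) (snd G T ≫ a) ≫ _ = _
        congr 1
      rw [h₁]
      exact (whiskerLeft_isPullback G a).paste_horiz b.isTorsor.isPullback)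
    (trivialTorsor_hom_ext (by
      change unitSection G T ≫ (orbitMap a).hom ≫ b.map.hom = unitSection G T ≫ (orbitMap x).hom
      rw [reassoc_of% (unitSection_orbitMap a), unitSection_orbitMap, h]))

/-- The unit section of a trivial torsor. -/
def unitPoint {T : Over S} (x : T ⟶ X.X) : T ⟶ (trivialObj x).total.X :=
  unitSection G T

/-- The point of the total space given by a morphism from a trivial torsor. -/
def pointOf {b : QuotientObj X} {T : Over S} {x : T ⟶ X.X} (φ : trivialObj x ⟶ b) :
    T ⟶ b.total.X :=
  unitPoint x ≫ (QuotientHom.total φ).hom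

@[simp]
lemma pointOf_pointHom {b : QuotientObj X} {T : Over S} (a : T ⟶ b.total.X) {x : T ⟶ X.X}
    (h : a ≫ b.map.hom = x) : pointOf (pointHom a h) = a :=
  unitSection_orbitMap a

lemma pointOf_proj {b : QuotientObj X} {T : Over S} {x : T ⟶ X.X} (φ : trivialObj x ⟶ b) :
    pointOf φ ≫ b.proj = QuotientHom.base φ := by
  rw [pointOf, Category.assoc, total_proj]
  exact unitSection_snd_assoc T _

lemma pointOf_map {b : QuotientObj X} {T : Over S} {x : T ⟶ X.X} (φ : trivialObj x ⟶ b) :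
    pointOf φ ≫ b.map.hom = x := by
  rw [pointOf, Category.assoc, total_map]
  exact unitSection_orbitMap x

lemma pointOf_comp {b c : QuotientObj X} {T : Over S} {x : T ⟶ X.X} (φ : trivialObj x ⟶ b)
    (u : b ⟶ c) : pointOf (φ ≫ u) = pointOf φ ≫ (QuotientHom.total u).hom :=
  (Category.assoc _ _ _).symm

lemma pointOf_injective {b : QuotientObj X} {T : Over S} {x : T ⟶ X.X} {φ φ' : trivialObj x ⟶ b}
    (h : pointOf φ = pointOf φ') : φ = φ' := by
  refine QuotientHom.ext ?_ (trivialTorsor_hom_ext h)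
  rw [← pointOf_proj, ← pointOf_proj, h]

/-- An object of `[X/G]` with a section is a trivial torsor. -/
lemma isIso_pointHom {b : QuotientObj X} {T : Over S} (s : T ⟶ b.total.X) (e : T ≅ b.base)
    (hs : s ≫ b.proj = e.hom) {x : T ⟶ X.X} (h : s ≫ b.map.hom = x) : IsIso (pointHom s h) := by
  have : IsIso (QuotientHom.base (pointHom s h)) := by
    change IsIso (s ≫ b.proj)
    rw [hs]
    infer_instance
  exact isIso_of_isIso_base _

/-- A section `s` identifies `b` with a trivial torsor, and a morphism out of a trivial torsor is
determined by the image of its unit section. -/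
lemma hom_ext_of_section {b c : QuotientObj X} {T : Over S} (s : T ⟶ b.total.X) (e : T ≅ b.base)
    (hs : s ≫ b.proj = e.hom) {u u' : b ⟶ c}
    (h : s ≫ (QuotientHom.total u).hom = s ≫ (QuotientHom.total u').hom) : u = u' := by
  have := isIso_pointHom s e hs rfl
  rw [← cancel_epi (pointHom s rfl)]
  apply pointOf_injective
  rw [pointOf_comp, pointOf_comp, pointOf_pointHom, h]

lemma exists_hom_of_section {b c : QuotientObj X} {T : Over S} (s : T ⟶ b.total.X)
    (e : T ≅ b.base) (hs : s ≫ b.proj = e.hom) (a : T ⟶ c.total.X)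
    (h : a ≫ c.map.hom = s ≫ b.map.hom) :
    ∃ u : b ⟶ c, s ≫ (QuotientHom.total u).hom = a := by
  have := isIso_pointHom s e hs rfl
  refine ⟨inv (pointHom s rfl) ≫ pointHom a h, ?_⟩
  calc s ≫ _ = pointOf (pointHom s rfl) ≫ _ := by rw [pointOf_pointHom]
    _ = a := by rw [← pointOf_comp, IsIso.hom_inv_id_assoc, pointOf_pointHom]

end QuotientObj

end

/-! ### Representable fibrations over `[X/G]` and universal sections -/

noncomputable section

variable {S : Scheme.{u}} {G : Over S} [GrpObj G] {X : Mod (Over S) G}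
variable {𝒟 : Type u₁} [Category.{v₁} 𝒟]

/-- A functor to `[X/G]` from a category fibred in groupoids (over the category of `S`-schemes,
via `[X/G]`), such that for every object `b` of `[X/G]` the category of pairs `(z, F z ⟶ b)` has a
terminal object. -/
structure IsRepresentableFibration (F : 𝒟 ⥤ QuotientObj X) : Prop where
  exists_lift (z : 𝒟) {T : Over S} (b : T ⟶ (F.obj z).base) :
    ∃ (w : 𝒟) (β : w ⟶ z) (e : T ≅ (F.obj w).base), e.hom ≫ QuotientHom.base (F.map β) = b
  exists_fac {a b c : 𝒟} (u : b ⟶ c) (v : a ⟶ c) (t : (F.obj a).base ⟶ (F.obj b).base)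
    (h : t ≫ QuotientHom.base (F.map u) = QuotientHom.base (F.map v)) :
    ∃ k : a ⟶ b, QuotientHom.base (F.map k) = t ∧ k ≫ u = v
  fac_unique {a b c : 𝒟} (u : b ⟶ c) {k k' : a ⟶ b}
    (h : QuotientHom.base (F.map k) = QuotientHom.base (F.map k')) (h' : k ≫ u = k' ≫ u) : k = k'
  exists_terminal (b : QuotientObj X) : ∃ (z : 𝒟) (κ : F.obj z ⟶ b),
    ∀ (w : 𝒟) (k : F.obj w ⟶ b), ∃! m : w ⟶ z, F.map m ≫ κ = k

/-- A universal object with a section: an object `z` of `𝒟` with a `Y`-point of the torsor `F z`,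
through which every object of `𝒟` with a section of its torsor factors uniquely. -/
structure UniversalSection (F : 𝒟 ⥤ QuotientObj X) (Y : Over S) where
  obj : 𝒟
  point : Y ⟶ (F.obj obj).total.X
  exists_hom (z : 𝒟) (σ : (F.obj z).base ⟶ (F.obj z).total.X) (hσ : σ ≫ (F.obj z).proj = 𝟙 _) :
    ∃ (β : z ⟶ obj) (y : (F.obj z).base ⟶ Y), σ ≫ (QuotientHom.total (F.map β)).hom = y ≫ point
  hom_unique (z : 𝒟) (σ : (F.obj z).base ⟶ (F.obj z).total.X) (hσ : σ ≫ (F.obj z).proj = 𝟙 _)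
    (β β' : z ⟶ obj) (y y' : (F.obj z).base ⟶ Y)
    (h : σ ≫ (QuotientHom.total (F.map β)).hom = y ≫ point)
    (h' : σ ≫ (QuotientHom.total (F.map β')).hom = y' ≫ point) : β = β' ∧ y = y'

variable {F : 𝒟 ⥤ QuotientObj X} {Y : Over S}

namespace IsRepresentableFibration

variable (hF : IsRepresentableFibration F)
include hF

/-- Pulling `z` back along `T → base` turns the point `a` of its torsor into a section `s`. -/
lemma exists_lift_point (z : 𝒟) {T : Over S} (a : T ⟶ (F.obj z).total.X) :
    ∃ (w : 𝒟) (β : w ⟶ z) (e : T ≅ (F.obj w).base) (s : T ⟶ (F.obj w).total.X),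
      s ≫ (QuotientHom.total (F.map β)).hom = a ∧ s ≫ (F.obj w).proj = e.hom := by
  obtain ⟨w, β, e, h⟩ := hF.exists_lift z (a ≫ (F.obj z).proj)
  have hβ := QuotientHom.isPullback (F.map β)
  exact ⟨w, β, e, hβ.lift a e.hom h.symm, hβ.lift_fst _ _ _, hβ.lift_snd _ _ _⟩

lemma exists_hom_of_point {v w z : 𝒟} {T : Over S} (b : v ⟶ z) (β : w ⟶ z)
    (t : T ⟶ (F.obj v).total.X) (e : T ≅ (F.obj v).base) (ht : t ≫ (F.obj v).proj = e.hom)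
    (s : T ⟶ (F.obj w).total.X)
    (h : t ≫ (QuotientHom.total (F.map b)).hom = s ≫ (QuotientHom.total (F.map β)).hom) :
    ∃ δ : v ⟶ w, δ ≫ β = b ∧ t ≫ (QuotientHom.total (F.map δ)).hom = s := by
  have h₀ : (e.inv ≫ s ≫ (F.obj w).proj) ≫ QuotientHom.base (F.map β) =
      QuotientHom.base (F.map b) := by
    rw [Category.assoc, Category.assoc, ← QuotientObj.total_proj, ← reassoc_of% h,
      QuotientObj.total_proj, reassoc_of% ht, e.inv_hom_id_assoc]
  obtain ⟨δ, hδ, hδ'⟩ := hF.exists_fac β b _ h₀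
  refine ⟨δ, hδ', (QuotientHom.isPullback (F.map β)).hom_ext ?_ ?_⟩
  · rw [← h, ← hδ', F.map_comp, QuotientObj.comp_total, Mod.comp_hom', Category.assoc]
  · rw [Category.assoc, QuotientObj.total_proj, reassoc_of% ht, hδ, e.hom_inv_id_assoc]

/-- Two arrows with the same image agree after composition with the arrow `ρ` to the terminal pair
over `F z₁`; since `ρ` is cartesian, it can be cancelled. -/
lemma faithful : F.Faithful where
  map_injective {z z₁ m ν} h := by
    obtain ⟨z₂, κ, hκ⟩ := hF.exists_terminal (F.obj z₁)
    obtain ⟨ρ, hρ, -⟩ := hκ z₁ (𝟙 _)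
    refine hF.fac_unique ρ (by rw [h]) ((hκ z (F.map m)).unique ?_ ?_)
    · rw [F.map_comp, Category.assoc, hρ, Category.comp_id]
    · rw [F.map_comp, Category.assoc, hρ, Category.comp_id, h]

end IsRepresentableFibration

/-! ### The action on `Y` and the functor to `[Y/G]` -/

namespace UniversalSection

variable (U : UniversalSection F Y)

lemma hom_unique' {z : 𝒟} {T : Over S} (e : T ≅ (F.obj z).base) {s : T ⟶ (F.obj z).total.X}
    (hs : s ≫ (F.obj z).proj = e.hom) {β β' : z ⟶ U.obj} {y y' : T ⟶ Y}
    (h : s ≫ (QuotientHom.total (F.map β)).hom = y ≫ U.point)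
    (h' : s ≫ (QuotientHom.total (F.map β')).hom = y' ≫ U.point) : β = β' ∧ y = y' := by
  have := U.hom_unique z (e.inv ≫ s) (by simp [hs]) β β' (e.inv ≫ y) (e.inv ≫ y') (by simp [h])
    (by simp [h'])
  exact ⟨this.1, (cancel_epi e.inv).1 this.2⟩

section

variable (hF : IsRepresentableFibration F)
include hF

/-- This is the moduli description of a point `a` of `F z`: the pullback `v` of `z` with its section
`s` is classified by a point `y` of `Y`. -/
lemma exists_span (z : 𝒟) {T : Over S} (a : T ⟶ (F.obj z).total.X) :
    ∃ (v : 𝒟) (β : v ⟶ z) (c : v ⟶ U.obj) (e : T ≅ (F.obj v).base)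
      (s : T ⟶ (F.obj v).total.X) (y : T ⟶ Y), s ≫ (F.obj v).proj = e.hom ∧
      s ≫ (QuotientHom.total (F.map β)).hom = a ∧
      s ≫ (QuotientHom.total (F.map c)).hom = y ≫ U.point := by
  obtain ⟨v, β, e, s, h₁, h₂⟩ := hF.exists_lift_point z a
  obtain ⟨c, y, h⟩ := U.exists_hom v (e.inv ≫ s) (by simp [h₂])
  exact ⟨v, β, c, e, s, e.hom ≫ y, h₂, h₁, by
    rw [Category.assoc, ← h, Category.assoc, e.hom_inv_id_assoc]⟩

/-- Independence of choices: both spans are compared on a common pullback `v`, where the universal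
property of `Y` applies. -/
lemma span_unique {z w w' : 𝒟} {T : Over S} {β : w ⟶ z} {c : w ⟶ U.obj}
    {s : T ⟶ (F.obj w).total.X} {y : T ⟶ Y} {β' : w' ⟶ z} {c' : w' ⟶ U.obj}
    {s' : T ⟶ (F.obj w').total.X} {y' : T ⟶ Y}
    (h : s ≫ (QuotientHom.total (F.map β)).hom = s' ≫ (QuotientHom.total (F.map β')).hom)
    (hy : s ≫ (QuotientHom.total (F.map c)).hom = y ≫ U.point)
    (hy' : s' ≫ (QuotientHom.total (F.map c')).hom = y' ≫ U.point) : y = y' := by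
  obtain ⟨v, ε, e, t, ht, ht'⟩ := hF.exists_lift_point w s
  obtain ⟨δ, -, hδ'⟩ := hF.exists_hom_of_point (ε ≫ β) β' t e ht' s' (by simp [reassoc_of% ht, h])
  exact (U.hom_unique' e ht' (β := ε ≫ c) (β' := δ ≫ c') (by simp [reassoc_of% ht, hy])
    (by simp [reassoc_of% hδ', hy'])).2

lemma exists_toBase (z : 𝒟) : ∃ (ψ : (F.obj z).total.X ⟶ Y) (v : 𝒟) (β : v ⟶ z) (c : v ⟶ U.obj)
    (s : (F.obj z).total.X ⟶ (F.obj v).total.X),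
      s ≫ (QuotientHom.total (F.map β)).hom = 𝟙 _ ∧
      s ≫ (QuotientHom.total (F.map c)).hom = ψ ≫ U.point := by
  obtain ⟨v, β, c, -, s, y, -, h₂, h₃⟩ := U.exists_span hF z (𝟙 _)
  exact ⟨y, v, β, c, s, h₂, h₃⟩

/-- The morphism from the total space of the torsor `F z` to `Y`. -/
def toBase (z : 𝒟) : (F.obj z).total.X ⟶ Y := (U.exists_toBase hF z).choose

lemma comp_toBase {z : 𝒟} {T : Over S} {s : T ⟶ (F.obj z).total.X} {c : z ⟶ U.obj} {y : T ⟶ Y}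
    (h : s ≫ (QuotientHom.total (F.map c)).hom = y ≫ U.point) : s ≫ U.toBase hF z = y := by
  obtain ⟨w, β, c', s', h₁, h₂⟩ := (U.exists_toBase hF z).choose_spec
  refine U.span_unique hF (β := β) (c := c') (s := s ≫ s') (β' := 𝟙 z) (s' := s) ?_ ?_ h
  · rw [Category.assoc, h₁]; simp
  · rw [Category.assoc, h₂, Category.assoc]; rfl

lemma exists_span' (z : 𝒟) {T : Over S} (a : T ⟶ (F.obj z).total.X) :
    ∃ (v : 𝒟) (β : v ⟶ z) (c : v ⟶ U.obj) (e : T ≅ (F.obj v).base)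
      (s : T ⟶ (F.obj v).total.X), s ≫ (F.obj v).proj = e.hom ∧
      s ≫ (QuotientHom.total (F.map β)).hom = a ∧
      s ≫ (QuotientHom.total (F.map c)).hom = a ≫ U.toBase hF z ≫ U.point := by
  obtain ⟨v, β, c, e, s, y, h₁, h₂, h₃⟩ := U.exists_span hF z a
  obtain ⟨w, β', c', s', h₄, h₅⟩ := (U.exists_toBase hF z).choose_spec
  refine ⟨v, β, c, e, s, h₁, h₂, ?_⟩
  have h : y = a ≫ U.toBase hF z := by
    refine U.span_unique hF (β := β) (β' := β') (c' := c') (s' := a ≫ s') ?_ h₃ ?_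
    · rw [Category.assoc, h₄, h₂]; simp
    · rw [Category.assoc, h₅, Category.assoc]; rfl
  rw [h₃, h, Category.assoc]

lemma map_toBase {w z : 𝒟} (m : w ⟶ z) :
    (QuotientHom.total (F.map m)).hom ≫ U.toBase hF z = U.toBase hF w := by
  obtain ⟨v, β, c, e, s, h₁, h₂, h₃⟩ := U.exists_span' hF w (𝟙 _)
  obtain ⟨v', β', c', e', s', h₁', h₂', h₃'⟩ :=
    U.exists_span' hF z (QuotientHom.total (F.map m)).hom
  refine U.span_unique hF (β := β') (s := s') (c := c') (s' := s) (β' := β ≫ m) ?_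
    (by simpa using h₃') (by simpa using h₃)
  simp [h₂', reassoc_of% h₂]

@[simp]
lemma point_toBase : U.point ≫ U.toBase hF U.obj = 𝟙 Y :=
  U.comp_toBase hF (c := 𝟙 _) (by simp)

lemma toBase_point_map (z : 𝒟) :
    U.toBase hF z ≫ U.point ≫ (F.obj U.obj).map.hom = (F.obj z).map.hom := by
  obtain ⟨v, β, c, e, s, h₁, h₂, h₃⟩ := U.exists_span' hF z (𝟙 _)
  rw [Category.id_comp] at h₃
  rw [← reassoc_of% h₃, QuotientObj.total_map, ← QuotientObj.total_map (F.map β), reassoc_of% h₂]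

/-- Equivariance of `toBase`, in a form available before the action on `Y` exists. Morphisms of
torsors are equivariant, so both sides can be computed from the section `g • s` of the span. -/
lemma smul_toBase (z : 𝒟) {T : Over S} (g : T ⟶ G) (a : T ⟶ (F.obj z).total.X) :
    (g • a) ≫ U.toBase hF z =
      (g • (a ≫ U.toBase hF z ≫ U.point)) ≫ U.toBase hF U.obj := by
  obtain ⟨v, β, c, e, s, h₁, h₂, h₃⟩ := U.exists_span' hF z a
  rw [← h₃, ← h₂, ← IsModHom.map_smul, ← IsModHom.map_smul, Category.assoc, Category.assoc,
    map_toBase, map_toBase]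

/-- The action map on `Y`. -/
def smul : G ⊗ Y ⟶ Y := (fst G Y • (snd G Y ≫ U.point)) ≫ U.toBase hF U.obj

lemma lift_smul {T : Over S} (g : T ⟶ G) (y : T ⟶ Y) :
    lift g y ≫ U.smul hF = (g • (y ≫ U.point)) ≫ U.toBase hF U.obj := by
  rw [smul, ← Category.assoc, ModObj.comp_smul]
  simp

/-- The action of `G` on `Y`. -/
@[reducible]
def modObj : ModObj G Y where
  smul := U.smul hF
  one_smul := by
    have h : η[G] ▷ Y = lift 1 (λ_ Y).hom := by
      ext <;> simp [leftUnitor_hom, MonObj.one_eq_one, MonObj.comp_one]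
    change η[G] ▷ Y ≫ U.smul hF = (λ_ Y).hom
    rw [h, lift_smul, one_smul]
    simp
  mul_smul := by
    have h₁ : μ[G] ▷ Y = lift ((fst (G ⊗ G) Y ≫ fst G G) * (fst (G ⊗ G) Y ≫ snd G G))
        (snd (G ⊗ G) Y) := by
      ext <;> simp [MonObj.mul_eq_mul, MonObj.comp_mul]
    have h₂ : (α_ G G Y).hom ≫ G ◁ U.smul hF = lift (fst (G ⊗ G) Y ≫ fst G G)
        (lift (fst (G ⊗ G) Y ≫ snd G G) (snd (G ⊗ G) Y) ≫ U.smul hF) := by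
      have h₃ : (α_ G G Y).hom ≫ snd G (G ⊗ Y) =
          lift (fst (G ⊗ G) Y ≫ snd G G) (snd (G ⊗ G) Y) := by
        apply CartesianMonoidalCategory.hom_ext <;> simp
      apply CartesianMonoidalCategory.hom_ext
      · simp
      · rw [Category.assoc, whiskerLeft_snd, lift_snd, reassoc_of% h₃]
    change μ[G] ▷ Y ≫ U.smul hF = (α_ G G Y).hom ≫ G ◁ U.smul hF ≫ U.smul hF
    rw [h₁, reassoc_of% h₂, lift_smul, lift_smul, lift_smul, mul_smul, smul_toBase]
    simp only [Category.assoc]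

lemma smul_eq {T : Over S} (g : T ⟶ G) (y : T ⟶ Y) :
    letI := U.modObj hF
    g • y = (g • (y ≫ U.point)) ≫ U.toBase hF U.obj :=
  U.lift_smul hF g y

/-- The scheme `Y` with its action of `G`. -/
def mod : Mod (Over S) G :=
  letI := U.modObj hF
  ⟨Y⟩

/-- The equivariant morphism from the total space of the torsor `F z` to `Y`. -/
def toBaseHom (z : 𝒟) : (F.obj z).total ⟶ U.mod hF :=
  Mod.Hom.mk' (U.toBase hF z) (by
    change γ[G, _] ≫ _ = G ◁ U.toBase hF z ≫ U.smul hF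
    have h₁ : G ◁ U.toBase hF z = lift (fst _ _) (snd _ _ ≫ U.toBase hF z) := by
      ext <;> simp
    have h₂ : γ[G, (F.obj z).total.X] = fst G (F.obj z).total.X • snd G (F.obj z).total.X := by
      rw [Hom.smul_def, lift_fst_snd, Category.id_comp]
    rw [h₁, lift_smul, h₂, smul_toBase, Category.assoc])

/-- The functor `z ↦ (F z, F z → Y)` to `[Y/G]`. -/
def functor : 𝒟 ⥤ QuotientObj (U.mod hF) where
  obj z :=
    { base := (F.obj z).base
      total := (F.obj z).total
      proj := (F.obj z).proj
      isTorsor := (F.obj z).isTorsor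
      map := U.toBaseHom hF z }
  map m :=
    { base := QuotientHom.base (a := F.obj _) (b := F.obj _) (F.map m)
      total := QuotientHom.total (a := F.obj _) (b := F.obj _) (F.map m)
      isPullback := QuotientHom.isPullback (F.map m)
      w := Mod.hom_ext _ _ (U.map_toBase hF m) }
  map_id z := by
    apply QuotientHom.ext
    · change QuotientHom.base (F.map (𝟙 z)) = _
      rw [F.map_id]; rfl
    · change QuotientHom.total (F.map (𝟙 z)) = _
      rw [F.map_id]; rfl
  map_comp m ν := by
    apply QuotientHom.ext
    · change QuotientHom.base (F.map (m ≫ ν)) = _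
      rw [F.map_comp]; rfl
    · change QuotientHom.total (F.map (m ≫ ν)) = _
      rw [F.map_comp]; rfl

lemma faithful_functor : (U.functor hF).Faithful where
  map_injective {z z₁ m ν} h := by
    have := hF.faithful
    have h₁ : QuotientHom.base ((U.functor hF).map m) = QuotientHom.base ((U.functor hF).map ν) :=
      congrArg _ h
    have h₂ : QuotientHom.total ((U.functor hF).map m) =
      QuotientHom.total ((U.functor hF).map ν) := congrArg _ h
    exact F.map_injective (QuotientHom.ext h₁ h₂)

end

end UniversalSection

end

noncomputable section

variable {S : Scheme.{u}} {G : Over S} [GrpObj G] {X : Mod (Over S) G}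
variable {𝒟 : Type u₁} [Category.{v₁} 𝒟] {F : 𝒟 ⥤ QuotientObj X} {Y : Over S}

/-! ### Fullness and essential surjectivity -/

namespace UniversalSection

variable [Smooth G.hom] (U : UniversalSection F Y) (hF : IsRepresentableFibration F)
include hF

/-- Over the total space of `F z`, both torsors acquire sections classified by the same map to `Y`,
so `k` lifts there; the terminal pair over `F z₁` then allows the lift to descend. -/
lemma exists_map_eq {z z₁ : 𝒟} (k : F.obj z ⟶ F.obj z₁)
    (hk : (QuotientHom.total k).hom ≫ U.toBase hF z₁ = U.toBase hF z) :
    ∃ m : z ⟶ z₁, F.map m = k := by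
  obtain ⟨z₂, κ, hκ⟩ := hF.exists_terminal (F.obj z₁)
  obtain ⟨m, hm, -⟩ := hκ z₁ (𝟙 _)
  obtain ⟨ν, hν, -⟩ := hκ z k
  obtain ⟨v, β, c, e, t, ht, htβ, htc⟩ := U.exists_span' hF z (𝟙 _)
  obtain ⟨v', β', c', e', t', ht', htβ', htc'⟩ := U.exists_span' hF z₁ (QuotientHom.total k).hom
  obtain ⟨δ, hδ, htδ⟩ := hF.exists_hom_of_point c c' t e ht t' (by
    rw [htc, htc', reassoc_of% hk, Category.id_comp])
  have hβ : F.map (δ ≫ β') = F.map β ≫ k := by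
    apply QuotientObj.hom_ext_of_section t e ht
    simp [reassoc_of% htδ, htβ', reassoc_of% htβ]
  -- `δ ≫ β'` lifts `k` over the total space; both composites are the arrow to the terminal pair
  -- with the same image.
  have h : (δ ≫ β') ≫ m = β ≫ ν := by
    refine (hκ v (F.map (δ ≫ β'))).unique ?_ ?_
    · rw [F.map_comp, Category.assoc, hm, Category.comp_id]
    · rw [F.map_comp, Category.assoc, hν, hβ]
  -- An equality of maps from the base of `z`, checked after the epimorphism `(F.obj z).proj`.
  have h₁ : QuotientHom.base k ≫ QuotientHom.base (F.map m) = QuotientHom.base (F.map ν) := by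
    have h₂ := congr(e.hom ≫ QuotientHom.base (F.map $h))
    have h₃ : e.hom ≫ QuotientHom.base (F.map β) = (F.obj z).proj := by
      rw [← ht, Category.assoc, ← QuotientObj.total_proj, reassoc_of% htβ]
    rw [F.map_comp, hβ, F.map_comp] at h₂
    simpa [reassoc_of% h₃, cancel_epi] using h₂
  obtain ⟨d, hd, hd'⟩ := hF.exists_fac m ν _ h₁
  refine ⟨d, ?_⟩
  rw [← Category.comp_id (F.map d), ← hm, ← Category.assoc, ← F.map_comp, hd', hν]

lemma full_functor : (U.functor hF).Full where
  map_surjective {z z₁} k := by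
    have hw : (QuotientHom.total k).hom ≫ U.toBase hF z₁ = U.toBase hF z :=
      congrArg Mod.Hom.hom (QuotientHom.w k)
    have hX : QuotientHom.total k ≫ (F.obj z₁).map = (F.obj z).map := by
      apply Mod.hom_ext
      change (QuotientHom.total k).hom ≫ (F.obj z₁).map.hom = (F.obj z).map.hom
      rw [← U.toBase_point_map hF z₁, ← U.toBase_point_map hF z, ← hw]
      exact (Category.assoc _ _ _).symm
    obtain ⟨m, hm⟩ := U.exists_map_eq hF (z := z) (z₁ := z₁)
      (QuotientHom.mk (a := F.obj z) (b := F.obj z₁) (QuotientHom.base (X := U.mod hF) k)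
        (QuotientHom.total (X := U.mod hF) k) (QuotientHom.isPullback (X := U.mod hF) k) hX) hw
    exact ⟨m, QuotientHom.ext (congrArg (QuotientHom.base (X := X)) hm)
      (congrArg (QuotientHom.total (X := X)) hm)⟩

/-- The equivariant morphism `Y → X`. -/
def modMap : U.mod hF ⟶ X :=
  Mod.Hom.mk' (M := U.mod hF) (U.point ≫ (F.obj U.obj).map.hom) (by
    change U.smul hF ≫ _ = G ◁ (U.point ≫ (F.obj U.obj).map.hom) ≫ γ[G, X.X]
    have h : G ◁ (U.point ≫ (F.obj U.obj).map.hom) =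
        lift (fst _ _) (snd _ _ ≫ U.point ≫ (F.obj U.obj).map.hom) := by
      apply CartesianMonoidalCategory.hom_ext <;> simp
    have h' : U.smul hF ≫ U.point ≫ (F.obj U.obj).map.hom =
        lift (fst _ _) (snd _ _ ≫ U.point ≫ (F.obj U.obj).map.hom) ≫ γ[G, X.X] := by
      rw [smul, Category.assoc, U.toBase_point_map hF, IsModHom.map_smul, Hom.smul_def,
        Category.assoc]
    exact h'.trans congr($h.symm ≫ _))

/-- The object of `[X/G]` underlying an object of `[Y/G]`. -/
def underlying (a : QuotientObj (U.mod hF)) : QuotientObj X where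
  base := a.base
  total := a.total
  proj := a.proj
  isTorsor := a.isTorsor
  map := a.map ≫ U.modMap hF

/-- Pull the universal object back along `ψ` to get `w` over the total space `P` of `b`. The map `F
w ⟶ b` gives a `P`-point of the base of the terminal pair `z₁`; this point is `G`-invariant, so it
descends to a map `r`, and `z` is the pullback of `z₁` along `r`. -/
lemma exists_obj (b : QuotientObj X) (ψ : b.total.X ⟶ Y)
    (hX : ψ ≫ U.point ≫ (F.obj U.obj).map.hom = b.map.hom)
    (hψ : ∀ {T : Over S} (g : T ⟶ G) (a : T ⟶ b.total.X),
      (g • a) ≫ ψ = (g • (a ≫ ψ ≫ U.point)) ≫ U.toBase hF U.obj) :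
    ∃ (z : 𝒟) (k : F.obj z ⟶ b), IsIso (QuotientHom.base k) ∧
      (QuotientHom.total k).hom ≫ ψ = U.toBase hF z := by
  obtain ⟨z₁, κ, hκ⟩ := hF.exists_terminal b
  obtain ⟨w, c, e, s, hsc, hs⟩ := hF.exists_lift_point U.obj (ψ ≫ U.point)
  have hsψ : s ≫ U.toBase hF w = ψ := U.comp_toBase hF hsc
  obtain ⟨l, hl⟩ := QuotientObj.exists_hom_of_section (c := b) s e hs (𝟙 _) (by
    rw [← QuotientObj.total_map (F.map c), reassoc_of% hsc, Category.id_comp, hX])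
  obtain ⟨m, hm, -⟩ := hκ w l
  have hinv {T : Over S} (g : T ⟶ G) (a : T ⟶ b.total.X) :
      (g • a) ≫ e.hom ≫ QuotientHom.base (F.map m) = a ≫ e.hom ≫ QuotientHom.base (F.map m) := by
    -- `v` maps to `w` by `β`, over the point `a`, and by `δ`, over `g • a`. After `l` both send `t`
    -- to `g • a`, so terminality gives `δ ≫ m = β ≫ m`.
    obtain ⟨v, β, c', f, t, ht, htβ, htc⟩ := U.exists_span' hF w (g • (a ≫ s))
    have h₁ : t ≫ (QuotientHom.total (F.map c')).hom =
        ((g • a) ≫ s) ≫ (QuotientHom.total (F.map c)).hom := by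
      rw [htc, Category.assoc, hsc, reassoc_of% (U.smul_toBase hF w g (a ≫ s)),
        reassoc_of% hsψ, reassoc_of% (hψ g a)]
    obtain ⟨δ, -, hδ⟩ := hF.exists_hom_of_point c' c t f ht _ h₁
    have h₂ : F.map δ ≫ l = F.map β ≫ l := by
      apply QuotientObj.hom_ext_of_section t f ht
      simp [reassoc_of% hδ, reassoc_of% htβ, hl]
    have h₃ : δ ≫ m = β ≫ m := (hκ v (F.map δ ≫ l)).unique (by simp [hm]) (by simp [hm, h₂])
    have h₄ := congr(t ≫ (F.obj v).proj ≫ QuotientHom.base (F.map $h₃))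
    simp only [F.map_comp, QuotientObj.comp_base, ← QuotientObj.total_proj_assoc,
      reassoc_of% hδ, reassoc_of% htβ] at h₄
    rwa [← Category.assoc (g • (a ≫ s)), QuotientObj.smul_proj, Category.assoc, reassoc_of% hs,
      Category.assoc, reassoc_of% hs] at h₄
  obtain ⟨r, hr⟩ := b.exists_desc (e.hom ≫ QuotientHom.base (F.map m)) (by
    have h₂ : γ[G, b.total.X] = fst G b.total.X • snd G b.total.X := by
      rw [Hom.smul_def, lift_fst_snd, Category.id_comp]
    rw [h₂, hinv])
  -- `r` is a section of the base of `κ`, so pulling `z₁` back along `r` gives an object over the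
  -- base of `b`.
  have hrκ : r ≫ QuotientHom.base κ = 𝟙 _ := by
    rw [← cancel_epi b.proj, reassoc_of% hr, ← QuotientObj.comp_base, hm, ← hs, Category.assoc,
      ← QuotientObj.total_proj, reassoc_of% hl, Category.comp_id]
  obtain ⟨z, n, e', hn⟩ := hF.exists_lift z₁ r
  have hbase : QuotientHom.base (F.map n ≫ κ) = e'.inv := by
    rw [← cancel_epi e'.hom, QuotientObj.comp_base, reassoc_of% hn, hrκ, e'.hom_inv_id]
  have hiso : IsIso (QuotientHom.base (F.map n ≫ κ)) := by
    rw [hbase]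
    infer_instance
  have := QuotientObj.isIso_of_isIso_base (F.map n ≫ κ)
  refine ⟨z, F.map n ≫ κ, hiso, ?_⟩
  -- `w` is a pullback of `z` via `δ`, so the classifying map of `z` can be read off from that of
  -- `w`, which is `ψ` along `s`.
  obtain ⟨δ, -, hδ⟩ := hF.exists_fac n m (e.inv ≫ b.proj ≫ e'.hom) (by
    rw [Category.assoc, Category.assoc, hn, hr, e.inv_hom_id_assoc])
  have h₁ : F.map δ = l ≫ inv (F.map n ≫ κ) := by
    rw [IsIso.eq_comp_inv, ← hm, ← hδ, F.map_comp, Category.assoc]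
  have h₂ : (QuotientHom.total (inv (F.map n ≫ κ))).hom ≫ U.toBase hF z = ψ := by
    rw [← hsψ, ← U.map_toBase hF δ, h₁, QuotientObj.comp_total, Mod.comp_hom', Category.assoc,
      reassoc_of% hl]
  rw [← h₂, ← Category.assoc, ← Mod.comp_hom', ← QuotientObj.comp_total, IsIso.hom_inv_id,
    QuotientObj.id_total, Mod.id_hom', Category.id_comp]

lemma essSurj_functor : (U.functor hF).EssSurj where
  mem_essImage a := by
    obtain ⟨z, k, hk, hk'⟩ := U.exists_obj hF (U.underlying hF a) a.map.hom rfl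
      (fun g x => (IsModHom.map_smul (M := G) a.map.hom g x).trans
        ((U.smul_eq hF g _).trans
          (congrArg (fun q => (g • q) ≫ U.toBase hF U.obj) (Category.assoc x a.map.hom U.point))))
    let k' : (U.functor hF).obj z ⟶ a :=
      QuotientHom.mk (a := (U.functor hF).obj z) (b := a) (QuotientHom.base (X := X) k)
        (QuotientHom.total (X := X) k) (QuotientHom.isPullback (X := X) k) (Mod.hom_ext _ _ hk')
    have : IsIso (QuotientHom.base k') := hk
    have := QuotientObj.isIso_of_isIso_base k'
    exact ⟨z, ⟨asIso k'⟩⟩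

lemma isEquivalence_functor : (U.functor hF).IsEquivalence where
  faithful := U.faithful_functor hF
  full := U.full_functor hF
  essSurj := U.essSurj_functor hF

end UniversalSection

end

/-! ### From categories fibred in groupoids to representable fibrations -/

section CFG

variable {𝒮 : Type u₁} [Category.{v₁} 𝒮]

/-- Every morphism of a category fibred in groupoids is strongly cartesian. -/
lemma IsCFG.isStronglyCartesian {𝒳 : BasedCategory.{v₂, u₂} 𝒮} (h𝒳 : IsCFG 𝒳) {R T : 𝒮}
    {a b : 𝒳.obj} (f : R ⟶ T) (φ : a ⟶ b) [𝒳.p.IsHomLift f φ] :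
    𝒳.p.IsStronglyCartesian f φ := by
  have := h𝒳.isFibered
  obtain ⟨c, ψ, hψ⟩ := IsPreFibered.exists_isCartesian 𝒳.p
    (IsHomLift.codomain_eq 𝒳.p f φ) f
  -- `φ` differs from a cartesian lift of `f` by a vertical arrow, which is invertible.
  have h := h𝒳.isIso_of_isHomLift_id (T := R) (Functor.IsCartesian.map 𝒳.p f ψ φ) inferInstance
  rw [← Functor.IsCartesian.fac 𝒳.p f ψ φ]
  have h₁ := Functor.IsStronglyCartesian.of_isIso 𝒳.p (𝟙 R) (Functor.IsCartesian.map 𝒳.p f ψ φ)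
  have h₂ : 𝒳.p.IsStronglyCartesian (𝟙 R ≫ f) (Functor.IsCartesian.map 𝒳.p f ψ φ ≫ ψ) :=
    inferInstance
  rwa [Category.id_comp] at h₂

end CFG

noncomputable section

variable {S : Scheme.{u}} {G : Over S} [GrpObj G] {X : Mod (Over S) G}
  {𝒴 : BasedCategory.{v₂, u₂} (Over S)}

/-- The functor underlying a morphism to `[X/G]`. -/
def functorToQuotient (f : BasedFunctor 𝒴 (quotientCFG X)) : 𝒴.obj ⥤ QuotientObj X :=
  f.toFunctor

lemma isHomLift_base (f : BasedFunctor 𝒴 (quotientCFG X)) {a b : 𝒴.obj} (φ : a ⟶ b) :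
    𝒴.p.IsHomLift (QuotientHom.base ((functorToQuotient f).map φ)) φ := by
  have : (quotientCFG X).p.IsHomLift (QuotientHom.base ((functorToQuotient f).map φ))
    (f.map φ) := IsHomLift.map (quotientCFG X).p (f.map φ)
  exact BasedFunctor.isHomLift_map f _ φ

lemma base_eq_of_isHomLift (f : BasedFunctor 𝒴 (quotientCFG X)) {a b : 𝒴.obj} (φ : a ⟶ b)
    (t : ((functorToQuotient f).obj a).base ⟶ ((functorToQuotient f).obj b).base)
    [𝒴.p.IsHomLift t φ] : QuotientHom.base ((functorToQuotient f).map φ) = t := by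
  have h := @BasedFunctor.preserves_isHomLift _ _ 𝒴 (quotientCFG X) f _ _ _ _ t φ ‹_›
  exact (@IsHomLift.eq_of_isHomLift _ _ _ _ (quotientCFG X).p (f.obj a) (f.obj b) t (f.map φ) h).symm

lemma exists_isTerminal_of_isEquivalence {Z : Over S} {𝒳 : BasedCategory.{v₂, u₂} (Over S)}
    (E : BasedFunctor (schemeCFG Z) 𝒳) (hE : E.toFunctor.IsEquivalence) :
    Nonempty (IsTerminal (E.obj (Over.mk (𝟙 Z)))) :=
  ⟨IsTerminal.isTerminalObj E.toFunctor _ (Over.mkIdTerminal (X := Z))⟩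

/-- Representability is applied to the morphism `b.base → [X/G]` defined by `b`. The image of the
identity of `Z` is terminal in the fibre product, and a pair `(z, k)` is the same datum as an object
of that fibre product. -/
lemma exists_terminal_of_isRepresentableMorphism {f : BasedFunctor 𝒴 (quotientCFG X)}
    (hf : IsRepresentableMorphism f) (b : QuotientObj X) :
    ∃ (z : 𝒴.obj) (κ : (functorToQuotient f).obj z ⟶ b),
      ∀ (w : 𝒴.obj) (k : (functorToQuotient f).obj w ⟶ b),
        ∃! m : w ⟶ z, (functorToQuotient f).map m ≫ κ = k := by
  obtain ⟨Z, E, hE⟩ := hf b.base b.pullbackFunctor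
  obtain ⟨hW⟩ := exists_isTerminal_of_isEquivalence E hE
  set W := E.obj (Over.mk (𝟙 Z))
  let x : Over b.base := W.obj.fst
  let φ : b.pullbackObj x.hom ≅ (functorToQuotient f).obj W.obj.snd := W.obj.iso
  refine ⟨W.obj.snd, φ.inv ≫ b.pullbackπ x.hom, fun z k => ?_⟩
  -- `k` exhibits `F z` as the pullback of `b` along its base map; `j` is this identification.
  obtain ⟨j, hj, hj'⟩ := QuotientObj.exists_fac k (b.pullbackπ (QuotientHom.base k)) (𝟙 _)
    (Category.id_comp _)
  have hj₀ : IsIso (QuotientHom.base j) := by rw [hj]; exact IsIso.id _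
  have hjiso : IsIso j := QuotientObj.isIso_of_isIso_base j
  let V : (fiberProduct b.pullbackFunctor f).obj :=
    { obj :=
        { fst := Over.mk (QuotientHom.base k)
          snd := z
          iso := @asIso (QuotientObj X) _ _ _ j hjiso }
      property := by
        have h := IsHomLift.map (quotientCFG X).p j
        have h' : (quotientCFG X).p.map j = 𝟙 _ := hj
        rw [h'] at h
        exact h }
  let p : V ⟶ W := hW.from V
  let p₁ : Over.mk (QuotientHom.base k) ⟶ x := p.hom.fst
  let p₂ : z ⟶ W.obj.snd := p.hom.snd
  let q : b.pullbackObj (QuotientHom.base k) ⟶ b.pullbackObj x.hom := b.pullbackFunctor.map p₁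
  have hq : q ≫ b.pullbackπ x.hom = b.pullbackπ (QuotientHom.base k) :=
    b.pullbackFunctor_map_π p₁
  have hp : q ≫ φ.hom = j ≫ (functorToQuotient f).map p₂ := p.hom.w
  refine ⟨p₂, ?_, fun m hm => ?_⟩
  · change (functorToQuotient f).map p₂ ≫ φ.inv ≫ b.pullbackπ x.hom = k
    rw [← cancel_epi j, ← reassoc_of% hp, φ.hom_inv_id_assoc, hq, hj']
  · let l : (functorToQuotient f).obj z ⟶ b.pullbackObj x.hom :=
      (functorToQuotient f).map m ≫ φ.inv
    have hl : l ≫ b.pullbackπ x.hom = k := by rw [← hm, Category.assoc]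
    let r₁ : Over.mk (QuotientHom.base k) ⟶ x :=
      Over.homMk (QuotientHom.base l) (congrArg QuotientHom.base hl)
    have hr : (b.pullbackFunctor.map r₁ : b.pullbackObj (QuotientHom.base k) ⟶
        b.pullbackObj x.hom) = j ≫ l := by
      refine QuotientObj.fac_unique (b.pullbackπ x.hom) ?_ ?_
      · refine (b.pullbackFunctor_map_base r₁).trans ?_
        rw [QuotientObj.comp_base, hj]
        exact (Category.id_comp _).symm
      · refine (b.pullbackFunctor_map_π r₁).trans ?_
        exact hj'.symm.trans ((congrArg (j ≫ ·) hl.symm).trans (Category.assoc _ _ _).symm)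
    let r : V ⟶ W := ObjectProperty.homMk
      { fst := r₁
        snd := m
        w := by
          refine (congrArg (· ≫ φ.hom) hr).trans ?_
          change (j ≫ (functorToQuotient f).map m ≫ φ.inv) ≫ φ.hom = _
          rw [Category.assoc, Category.assoc, φ.inv_hom_id, Category.comp_id]
          rfl }
    exact congrArg (fun t : V ⟶ W => t.hom.snd) (hW.hom_ext r p)

lemma isRepresentableFibration (h𝒴 : IsCFG 𝒴) {f : BasedFunctor 𝒴 (quotientCFG X)}
    (hf : IsRepresentableMorphism f) : IsRepresentableFibration (functorToQuotient f) where
  exists_lift z T b := by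
    have := h𝒴.isFibered
    obtain ⟨w, β, hβ⟩ := IsPreFibered.exists_isCartesian 𝒴.p (f.w_obj z).symm b
    have hlift := @BasedFunctor.preserves_isHomLift _ _ 𝒴 (quotientCFG X) f _ _ _ _ b β
      hβ.toIsHomLift
    have hw : (quotientCFG X).p.obj (f.obj w) = T := IsHomLift.domain_eq (quotientCFG X).p b (f.map β)
    have hb := IsHomLift.fac (quotientCFG X).p b (f.map β)
    exact ⟨w, β, eqToIso hw.symm,
      (congrArg (eqToHom hw.symm ≫ ·) (Category.comp_id _).symm).trans hb.symm⟩
  exists_fac {a b c} u v t h := by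
    have h₁ := isHomLift_base f u
    have h₂ := isHomLift_base f v
    have h₃ := h𝒴.isStronglyCartesian (QuotientHom.base ((functorToQuotient f).map u)) u
    obtain ⟨k, ⟨hk, hk'⟩, -⟩ := Functor.IsStronglyCartesian.universal_property 𝒴.p
      (QuotientHom.base ((functorToQuotient f).map u)) u t _ h.symm v
    exact ⟨k, base_eq_of_isHomLift f k t, hk'⟩
  fac_unique {a b c} u k k' h h' := by
    have h₁ := isHomLift_base f u
    have h₂ := isHomLift_base f k
    have h₂' := isHomLift_base f k'
    rw [← h] at h₂'
    have h₃ := h𝒴.isStronglyCartesian (QuotientHom.base ((functorToQuotient f).map u)) u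
    exact Functor.IsStronglyCartesian.ext 𝒴.p (QuotientHom.base ((functorToQuotient f).map u)) u
      (QuotientHom.base ((functorToQuotient f).map k)) h'
  exists_terminal := exists_terminal_of_isRepresentableMorphism hf

/-! ### The fibre product `X ×_[X/G] 𝒴` in terms of points of torsors -/

variable [Smooth G.hom] {f : BasedFunctor 𝒴 (quotientCFG X)}

/-- The point of the torsor defined by an object of `X ×_[X/G] 𝒴`. -/
def fiberPoint (V : (fiberProduct (quotientMap X) f).obj) :
    V.obj.fst.left ⟶ ((functorToQuotient f).obj V.obj.snd).total.X :=
  QuotientObj.pointOf (b := (functorToQuotient f).obj V.obj.snd) (T := V.obj.fst.left)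
    (x := V.obj.fst.hom) V.obj.iso.hom

lemma fiberPoint_map (V : (fiberProduct (quotientMap X) f).obj) :
    fiberPoint V ≫ ((functorToQuotient f).obj V.obj.snd).map.hom = V.obj.fst.hom :=
  QuotientObj.pointOf_map (b := (functorToQuotient f).obj V.obj.snd) (T := V.obj.fst.left)
    (x := V.obj.fst.hom) V.obj.iso.hom

lemma pointOf_quotientMap_map {b : QuotientObj X} {x x' : Over X.X} (p : x ⟶ x')
    (φ : QuotientObj.trivialObj x'.hom ⟶ b) :
    QuotientObj.pointOf (x := x.hom) (b := b) ((quotientMap X).map p ≫ φ) =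
      p.left ≫ QuotientObj.pointOf φ := by
  have h := unitSection_trivialTorsorMap (G := G) p.left
  have h' := congrArg (· ≫ (QuotientHom.total φ).hom) h
  exact (Category.assoc _ _ _).symm.trans (h'.trans (Category.assoc _ _ _))

/-- Morphisms of `X ×_[X/G] 𝒴` in terms of points of torsors. -/
lemma fiberPoint_comp {V V' : (fiberProduct (quotientMap X) f).obj} (p : V ⟶ V') :
    fiberPoint V ≫ (QuotientHom.total ((functorToQuotient f).map p.hom.snd)).hom =
      p.hom.fst.left ≫ fiberPoint V' := by
  have h := congrArg (QuotientObj.pointOf (b := (functorToQuotient f).obj V'.obj.snd)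
    (T := V.obj.fst.left) (x := V.obj.fst.hom)) p.hom.w
  exact (QuotientObj.pointOf_comp _ _).symm.trans
    (h.symm.trans (pointOf_quotientMap_map p.hom.fst V'.obj.iso.hom))

lemma exists_fiber_hom {V V' : (fiberProduct (quotientMap X) f).obj}
    (β : V.obj.snd ⟶ V'.obj.snd) (y : V.obj.fst.left ⟶ V'.obj.fst.left)
    (h : fiberPoint V ≫ (QuotientHom.total ((functorToQuotient f).map β)).hom =
      y ≫ fiberPoint V') : ∃ p : V ⟶ V', p.hom.snd = β ∧ p.hom.fst.left = y := by
  let p₁ : V.obj.fst ⟶ V'.obj.fst := Over.homMk y (by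
    rw [← fiberPoint_map V', ← fiberPoint_map V, ← reassoc_of% h, QuotientObj.total_map])
  refine ⟨ObjectProperty.homMk { fst := p₁, snd := β, w := ?_ }, rfl, rfl⟩
  refine QuotientObj.pointOf_injective (b := (functorToQuotient f).obj V'.obj.snd)
    (T := V.obj.fst.left) (x := V.obj.fst.hom) ?_
  exact (pointOf_quotientMap_map p₁ V'.obj.iso.hom).trans
    (h.symm.trans (QuotientObj.pointOf_comp _ _).symm)

/-- The object of `X ×_[X/G] 𝒴` given by an object of `𝒴` and a section of its torsor. -/
def fiberObj (f : BasedFunctor 𝒴 (quotientCFG X)) (z : 𝒴.obj)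
    (σ : ((functorToQuotient f).obj z).base ⟶ ((functorToQuotient f).obj z).total.X)
    (hσ : σ ≫ ((functorToQuotient f).obj z).proj = 𝟙 _) :
    (fiberProduct (quotientMap X) f).obj where
  obj :=
    { fst := Over.mk (σ ≫ ((functorToQuotient f).obj z).map.hom)
      snd := z
      iso := @asIso (QuotientObj X) _ _ _ (QuotientObj.pointHom σ rfl)
        (QuotientObj.isIso_pointHom σ (Iso.refl _) hσ rfl) }
  property := by
    have h := IsHomLift.map (quotientCFG X).p (QuotientObj.pointHom σ rfl)
    have h' : (quotientCFG X).p.map (QuotientObj.pointHom σ rfl) = 𝟙 _ := hσ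
    rw [h'] at h
    exact h

lemma fiberPoint_fiberObj (z : 𝒴.obj)
    (σ : ((functorToQuotient f).obj z).base ⟶ ((functorToQuotient f).obj z).total.X)
    (hσ : σ ≫ ((functorToQuotient f).obj z).proj = 𝟙 _) :
    fiberPoint (fiberObj f z σ hσ) = σ :=
  QuotientObj.pointOf_pointHom σ rfl

/-! ### The universal section and classifying maps -/

section Universal

variable {Y : Over S} (E : BasedFunctor (schemeCFG Y) (fiberProduct (quotientMap X) f))

/-- The base of the object of `X ×_[X/G] 𝒴` corresponding to `y : T ⟶ Y` is `T`. -/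
def baseIso {T : Over S} (y : T ⟶ Y) : (E.obj (Over.mk y)).obj.fst.left ≅ T :=
  eqToIso (E.w_obj (Over.mk y))

lemma map_fst_left {T T' : Over S} {y : T ⟶ Y} {y' : T' ⟶ Y} (p : Over.mk y ⟶ Over.mk y') :
    (E.map p).hom.fst.left = (baseIso E y).hom ≫ p.left ≫ (baseIso E y').inv :=
  Functor.congr_hom E.w p

/-- The universal object with a section defined by a scheme representing `X ×_[X/G] 𝒴`. -/
def universalSection (hE : E.toFunctor.IsEquivalence) :
    UniversalSection (functorToQuotient f) Y where
  obj := (E.obj (Over.mk (𝟙 Y))).obj.snd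
  point := (baseIso E (𝟙 Y)).inv ≫ fiberPoint (E.obj (Over.mk (𝟙 Y)))
  exists_hom z σ hσ := by
    obtain ⟨hW⟩ := exists_isTerminal_of_isEquivalence E hE
    let p : fiberObj f z σ hσ ⟶ E.obj (Over.mk (𝟙 Y)) := hW.from _
    let y : ((functorToQuotient f).obj z).base ⟶ (E.obj (Over.mk (𝟙 Y))).obj.fst.left :=
      p.hom.fst.left
    have h := fiberPoint_comp p
    rw [fiberPoint_fiberObj] at h
    refine ⟨p.hom.snd, y ≫ (baseIso E (𝟙 Y)).hom, ?_⟩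
    rw [Category.assoc, Iso.hom_inv_id_assoc]
    exact h
  hom_unique z σ hσ β β' y y' h h' := by
    obtain ⟨hW⟩ := exists_isTerminal_of_isEquivalence E hE
    have h₀ := fiberPoint_fiberObj (f := f) z σ hσ
    obtain ⟨p, hp, hp'⟩ := exists_fiber_hom (V := fiberObj f z σ hσ) (V' := E.obj (Over.mk (𝟙 Y)))
      β (y ≫ (baseIso E (𝟙 Y)).inv) ((congrArg (· ≫ _) h₀).trans
        (h.trans (Category.assoc _ _ _).symm))
    obtain ⟨q, hq, hq'⟩ := exists_fiber_hom (V := fiberObj f z σ hσ) (V' := E.obj (Over.mk (𝟙 Y)))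
      β' (y' ≫ (baseIso E (𝟙 Y)).inv) ((congrArg (· ≫ _) h₀).trans
        (h'.trans (Category.assoc _ _ _).symm))
    have hpq : p = q := hW.hom_ext p q
    subst hpq
    exact ⟨hp.symm.trans hq, (cancel_mono (baseIso E (𝟙 Y)).inv).1 (hp'.symm.trans hq')⟩

variable (hE : E.toFunctor.IsEquivalence)
  (hF : IsRepresentableFibration (functorToQuotient f))

/-- The point of `Y` corresponding to an object of `X ×_[X/G] 𝒴`. -/
def classify (V : (fiberProduct (quotientMap X) f).obj) : V.obj.fst.left ⟶ Y :=
  fiberPoint V ≫ (universalSection E hE).toBase hF V.obj.snd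

lemma classify_comp {V V' : (fiberProduct (quotientMap X) f).obj} (p : V ⟶ V') :
    p.hom.fst.left ≫ classify E hE hF V' = classify E hE hF V := by
  rw [classify, ← Category.assoc, ← fiberPoint_comp, Category.assoc, UniversalSection.map_toBase,
    classify]

lemma classify_obj {T : Over S} (y : T ⟶ Y) :
    classify E hE hF (E.obj (Over.mk y)) = (baseIso E y).hom ≫ y := by
  have h : (baseIso E (𝟙 Y)).inv ≫ classify E hE hF (E.obj (Over.mk (𝟙 Y))) = 𝟙 Y :=
    (Category.assoc _ _ _).symm.trans ((universalSection E hE).point_toBase hF)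
  have h' : (E.map (Over.homMk y : Over.mk y ⟶ Over.mk (𝟙 Y))).hom.fst.left =
    (baseIso E y).hom ≫ y ≫ (baseIso E (𝟙 Y)).inv := map_fst_left E _
  rw [← classify_comp E hE hF (E.map (Over.homMk y : Over.mk y ⟶ Over.mk (𝟙 Y))), h',
    Category.assoc, Category.assoc, h, Category.comp_id]

/-- Precomposing the trivialization with right translation by `g` replaces the unit section by its
`g`-translate, hence the section by `g • fiberPoint V`. -/
lemma classify_smul (V : (fiberProduct (quotientMap X) f).obj) (g : V.obj.fst.left ⟶ G) :
    letI := (universalSection E hE).modObj hF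
    classify E hE hF (fiberProductSMul f V g) = g • classify E hE hF V := by
  have h : fiberPoint (fiberProductSMul f V g) = g • fiberPoint V := by
    let τ : trivialTorsor G V.obj.fst.left ⟶ ((functorToQuotient f).obj V.obj.snd).total :=
      QuotientHom.total (X := X) V.obj.iso.hom
    have h₁ := congrArg (· ≫ τ.hom) (unitSection_rightTranslation g)
    exact (Category.assoc _ _ _).symm.trans (h₁.trans (IsModHom.map_smul τ.hom _ _))
  refine (congrArg (· ≫ _) h).trans ?_
  refine ((universalSection E hE).smul_toBase hF _ g _).trans ?_
  refine Eq.trans ?_ ((universalSection E hE).smul_eq hF g _).symm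
  rw [classify, Category.assoc]

end Universal

end

/-! ### Existence and uniqueness of the induced action -/

section

variable {S : Scheme.{u}} {G : Over S} [GrpObj G] [Smooth G.hom] {X : Mod (Over S) G}
  {𝒴 : BasedCategory.{v₂, u₂} (Over S)} {f : BasedFunctor 𝒴 (quotientCFG X)} {Y : Over S}
  (E : BasedFunctor (schemeCFG Y) (fiberProduct (quotientMap X) f))
  (hE : E.toFunctor.IsEquivalence) (hF : IsRepresentableFibration (functorToQuotient f))

lemma modObj_ext_of_smul_eq {C : Type u₁} [Category.{v₁} C] [CartesianMonoidalCategory C]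
    {G : C} [GrpObj G] {Y : C} (act act' : ModObj G Y)
    (h : ∀ (T : C) (g : T ⟶ G) (y : T ⟶ Y),
      (letI := act; g • y) = (letI := act'; g • y)) : act = act' := by
  apply ModObj.ext
  have h₀ := h (G ⊗ Y) (fst G Y) (snd G Y)
  simpa only [Hom.smul_def, lift_fst_snd, Category.id_comp] using h₀

lemma classify_smul_obj {T : Over S} (g : T ⟶ G) (y : T ⟶ Y) :
    letI := (universalSection E hE).modObj hF
    classify E hE hF (fiberProductSMul f (E.obj (Over.mk y)) (eqToHom (E.w_obj (Over.mk y)) ≫ g)) =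
      (baseIso E y).hom ≫ (g • y) := by
  let := (universalSection E hE).modObj hF
  rw [ModObj.comp_smul, ← classify_obj E hE hF y]
  exact classify_smul E hE hF (E.obj (Over.mk y)) _

/-- Objects of `X ×_[X/G] 𝒴` are classified by points of `Y`. -/
lemma exists_iso_of_classify_eq {T : Over S} (V : (fiberProduct (quotientMap X) f).obj)
    (i : V.obj.fst.left ≅ T) (hi : (fiberProduct (quotientMap X) f).p.obj V = T)
    (hi' : i = eqToIso hi) (y : T ⟶ Y) (h : classify E hE hF V = i.hom ≫ y) :
    ∃ θ : E.obj (Over.mk y) ≅ V, (fiberProduct (quotientMap X) f).p.IsHomLift (𝟙 T) θ.hom := by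
  -- Essential surjectivity gives `V ≅ E y'` for some point `y'`; comparing classifying maps
  -- identifies `y'` with `y` along the isomorphism of bases `t`.
  obtain ⟨T', y', ⟨ε⟩⟩ : ∃ (T' : Over S) (y' : T' ⟶ Y), Nonempty (E.obj (Over.mk y') ≅ V) :=
    let Z : Over Y := E.toFunctor.objPreimage V
    ⟨Z.left, Z.hom, ⟨E.toFunctor.objObjPreimageIso V⟩⟩
  let ε' : (E.obj (Over.mk y')).obj.fst.left ≅ V.obj.fst.left :=
    (fiberProduct (quotientMap X) f).p.mapIso ε
  have hε : ε'.hom ≫ classify E hE hF V = (baseIso E y').hom ≫ y' :=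
    (classify_comp E hE hF ε.hom).trans (classify_obj E hE hF y')
  let t : T ≅ T' := i.symm ≪≫ ε'.symm ≪≫ baseIso E y'
  have ht : t.hom ≫ y' = y := by
    simp only [t, Iso.trans_hom, Iso.symm_hom, Category.assoc]
    rw [← hε, ε'.inv_hom_id_assoc, h, i.inv_hom_id_assoc]
  let α : Over.mk y ≅ Over.mk y' := Over.isoMk t ht
  refine ⟨E.toFunctor.mapIso α ≪≫ ε, ?_⟩
  have hα : (E.map α.hom).hom.fst.left = (baseIso E y).hom ≫ t.hom ≫ (baseIso E y').inv :=
    map_fst_left E α.hom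
  refine IsHomLift.of_fac' _ _ _ (E.w_obj (Over.mk y)) hi ?_
  change (E.map α.hom).hom.fst.left ≫ ε'.hom = _
  rw [hα, Category.id_comp]
  change _ = (baseIso E y).hom ≫ (eqToIso hi).inv
  rw [← hi']
  simp only [t, Iso.trans_hom, Iso.symm_hom, Category.assoc, Iso.hom_inv_id_assoc,
    Iso.inv_hom_id, Category.comp_id]
  rfl

lemma isInducedAction_modObj : IsInducedAction f E ((universalSection E hE).modObj hF) := by
  intro T g y
  let := (universalSection E hE).modObj hF
  exact exists_iso_of_classify_eq E hE hF
    (fiberProductSMul f (E.obj (Over.mk y)) (eqToHom (E.w_obj (Over.mk y)) ≫ g))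
    (baseIso E y) (E.w_obj (Over.mk y)) rfl _
    (classify_smul_obj E hE hF g y)

/-- Isomorphic objects over `T` have the same classifying map, so `θ` forces the value of `g • y`.
-/
lemma eq_modObj_of_isInducedAction (act : ModObj G Y) (h : IsInducedAction f E act) :
    act = (universalSection E hE).modObj hF := by
  apply modObj_ext_of_smul_eq
  intro T g y
  obtain ⟨θ, hθ⟩ := h T g y
  have h₁ := classify_comp E hE hF θ.hom
  have h₂ : θ.hom.hom.fst.left = _ := IsHomLift.fac' (fiberProduct (quotientMap X) f).p (𝟙 T) θ.hom
  have h₃ : θ.hom.hom.fst.left ≫ (baseIso E y).hom =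
      (baseIso E (letI := act; g • y)).hom := by
    refine (congrArg (· ≫ eqToHom (E.w_obj (Over.mk y))) h₂).trans ?_
    rw [Category.id_comp, eqToHom_trans]
    exact eqToHom_trans _ _
  rw [classify_smul_obj, classify_obj] at h₁
  exact ((cancel_epi (baseIso E (letI := act; g • y)).hom).1
    ((congrArg (· ≫ _) h₃).symm.trans ((Category.assoc _ _ _).trans h₁))).symm

end

theorem mainTheorem11 {S : Scheme.{u}} (G : Over S) [GrpObj G] [Smooth G.hom]
    (X : Mod (Over S) G) (𝒴 : BasedCategory.{v₂, u₂} (Over S)) (h𝒴 : IsCFG 𝒴)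
    (f : BasedFunctor 𝒴 (quotientCFG X)) (hf : IsRepresentableMorphism f) :
    (∃ Y : Over S, IsRepresentedBy (fiberProduct (quotientMap X) f) Y) ∧
    ∀ (Y : Over S) (E : BasedFunctor (schemeCFG Y) (fiberProduct (quotientMap X) f)),
      E.toFunctor.IsEquivalence →
      ∃ act : ModObj G Y, IsInducedAction f E act ∧
        (∀ act' : ModObj G Y, IsInducedAction f E act' → act' = act) ∧
        CFGEquivalent 𝒴 (quotientCFG (⟨Y⟩ : Mod (Over S) G)) := by
  -- The first claim is representability of `f` tested on `X → [X/G]`.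
  refine ⟨hf X.X (quotientMap X), fun Y E hE => ?_⟩
  have hF := isRepresentableFibration h𝒴 hf
  exact ⟨(universalSection E hE).modObj hF, isInducedAction_modObj E hE hF,
    eq_modObj_of_isInducedAction E hE hF,
    ⟨{ toFunctor := (universalSection E hE).functor hF, w := f.w },
      (universalSection E hE).isEquivalence_functor hF⟩⟩
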